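/- Let $d\ge 1$ and let $\mathcal A$ be a finite-dimensional $C^*$-algebra (realized, without loss of generality, as a unital $*$-subalgebra of some $M_N(\mathbb C)$). For finite $\Lambda\subset\mathbb Z^d$ put $\mathcal O_\Lambda=\bigotimes_{x\in\Lambda}\mathcal A$, let $\mathcal O$ be the $C^*$-inductive limit of the $\mathcal O_\Lambda$, with translations $\tau_x$, and for arbitrary $R\subset\mathbb Z^d$ let $\mathcal O_R\subset\mathcal O$ be the $C^*$-subalgebra generated by the observables at sites of $R$. Let $\Lambda(n)=\{z\in\mathbb Z^d: 0\le z_i\le n-1\}$. An *interaction* $\Psi=(\psi_X)$ assigns to each finite $X\subset\mathbb Z^d$ a self-adjoint $\psi_X\in\mathcal O_X$ such that $\tau_x(\psi_X)=\psi_{X+x}$. It is *classical* if there is an abelian unital $*$-subalgebra $\mathcal A^{(cl)}\subset\mathcal A$ such that every $\psi_X$ lies in the $C^*$-subalgebra $\mathcal O^{(cl)}\subset\mathcal O$ generated by the copies of $\mathcal A^{(cl)}$ at all sites. Put $\|\Psi\|=\sum_{X\ni 0}|X|^{-1}\|\psi_X\|$ and $K_\Lambda=\sum_{X\subset\Lambda}\psi_X$.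 A state $\omega$ on $\mathcal O$ is *asymptotically decoupled* if there are $g:\mathbb N\to\mathbb N$ with $g(m)/m\to 0$ and $c:\mathbb N\to[0,\infty)$ with $c(m)/m^d\to 0$ such that for every $m$, every cube $C(m)\subset\mathbb Z^d$ of side length $m$, with concentric cube $C^{g(m)}(m)$ of side length $m+2g(m)$, and all nonnegative $A\in\mathcal O_{C(m)}$ and $B\in\mathcal O_{C^{g(m)}(m)^c}$, $$e^{-c(m)}\omega(A)\omega(B)\le\omega(AB)\le e^{c(m)}\omega(A)\omega(B).$$ **Theorem.** Let $\Psi$ be a classical interaction with $\|\Psi\|<\infty$ and let $\omega$ be a translation invariant, asymptotically decoupled state on $\mathcal O$. Let $\mu_n(A)=\omega\big(\mathbf I_A(|\Lambda(n)|^{-1}K_{\Lambda(n)})\big)$ for Borel $A\subset\mathbb R$, where $\mathbf I_A(H)$ is the spectral projection of $H$ for $A$. Then the $\mu_n$ are Borel probability measures on $\mathbb R$ and satisfy a large deviation principle on the scale $|\Lambda(n)|$ with a concave rate function $s:\mathbb R\to[-\infty,0]$; that is, $I=-s:\mathbb R\to[0,\infty]$ is convex, lower semicontinuous with compact level sets $\{I\le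 a\}$, $a<\infty$, and $$\limsup_{n\to\infty}\frac{1}{|\Lambda(n)|}\log\mu_n(C)\le\sup_{x\in C}s(x),\qquad \liminf_{n\to\infty}\frac{1}{|\Lambda(n)|}\log\mu_n(O)\ge\sup_{x\in O}s(x)$$ for all closed $C$ and all open $O$. Moreover, for every $\alpha\in\mathbb R$ the limit $$f(\alpha)=\lim_{n\to\infty}\frac{1}{|\Lambda(n)|}\log\omega\big(\exp(\alpha K_{\Lambda(n)})\big)$$ exists and is finite, and $$s(x)=\inf_{\alpha\in\mathbb R}\big(f(\alpha)-\alpha x\big)\qquad\text{for all }x\in\mathbb R.$$ -/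

import Mathlib

open MeasureTheory Filter Topology
open scoped NNReal ENNReal Pointwise

noncomputable section

namespace QuantumSpin

/-! ### Large deviation principles -/

/-- `μ n` satisfies a large deviation principle on the scale `v n` with rate function
`I : X → [0, ∞]` (lower semicontinuous with compact level sets). -/
structure LargeDeviationPrinciple {X : Type*} [TopologicalSpace X] [MeasurableSpace X]
    (μ : ℕ → Measure X) (v : ℕ → ℝ) (I : X → ℝ≥0∞) : Prop where
  scale : Tendsto v atTop atTop
  lowerSemicontinuous : LowerSemicontinuous I
  isCompact_level : ∀ a : ℝ≥0, IsCompact {x | I x ≤ a}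
  upper : ∀ C : Set X, IsClosed C →
    limsup (fun n => ((1 / v n : ℝ) : EReal) * ENNReal.log (μ n C)) atTop
      ≤ -(⨅ x ∈ C, (I x : EReal))
  lower : ∀ O : Set X, IsOpen O →
    -(⨅ x ∈ O, (I x : EReal))
      ≤ liminf (fun n => ((1 / v n : ℝ) : EReal) * ENNReal.log (μ n O)) atTop

/-! ### The quantum spin algebra

The one-site algebra is a unital `*`-subalgebra `𝒜` of a matrix algebra `M_N(ℂ)`; up to
`*`-isomorphism these are exactly the finite-dimensional `C*`-algebras.  The `C*`-inductive limit
of the tensor products `⨂_{x ∈ Λ} 𝒜` is realized concretely on the Hilbert space `ℓ²` of the set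
of configurations `ℤ^d → {1, …, N}`: a matrix `a` at the site `x` acts on the `x`-th coordinate of
the configuration.  For finite `Λ` this is a faithful representation of `⨂_{x ∈ Λ} M_N(ℂ)`,
compatible with the embeddings `A ↦ A ⊗ 1`, hence isometric. -/

/-- The lattice `ℤ^d`. -/
abbrev Lattice (d : ℕ) : Type := Fin d → ℤ

/-- Configurations. -/
abbrev Conf (d N : ℕ) : Type := Lattice d → Fin N

/-- The Hilbert space `ℓ²(Conf)`. -/
abbrev Hil (d N : ℕ) : Type := lp (fun _ : Conf d N => ℂ) 2

/-- Bounded operators on `ℓ²(Conf)`. -/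
abbrev Op (d N : ℕ) : Type := Hil d N →L[ℂ] Hil d N

section Operators

variable {d N : ℕ}

open Classical in
/-- The sequence `σ ↦ ξ (φ σ)` for `σ ∈ P`, and `0` elsewhere. -/
def pullFun (P : Set (Conf d N)) (φ : Conf d N → Conf d N) (ξ : Hil d N) (σ : Conf d N) : ℂ :=
  if σ ∈ P then ξ (φ σ) else 0

theorem sum_pullFun_le {P : Set (Conf d N)} {φ : Conf d N → Conf d N} (h : Set.InjOn φ P)
    (ξ : Hil d N) (s : Finset (Conf d N)) :
    ∑ σ ∈ s, ‖pullFun P φ ξ σ‖ ^ (2 : ℝ≥0∞).toReal ≤ ‖ξ‖ ^ (2 : ℝ≥0∞).toReal := by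
  classical
  have h2 : 0 < (2 : ℝ≥0∞).toReal := by norm_num
  have e : ∑ σ ∈ s, ‖pullFun P φ ξ σ‖ ^ (2 : ℝ≥0∞).toReal
      = ∑ σ ∈ s.filter (· ∈ P), ‖ξ (φ σ)‖ ^ (2 : ℝ≥0∞).toReal := by
    rw [Finset.sum_filter]
    refine Finset.sum_congr rfl fun σ _ => ?_
    unfold pullFun
    split_ifs <;> simp
  rw [e, ← Finset.sum_image (f := fun τ => ‖ξ τ‖ ^ (2 : ℝ≥0∞).toReal) (g := φ)]
  · exact lp.sum_rpow_le_norm_rpow h2 ξ _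
  · intro a ha b hb hab
    simp only [Finset.coe_filter, Set.mem_ofPred_eq] at ha hb
    exact h ha.2 hb.2 hab

/-- The bounded operator `(T ξ)(σ) = ξ (φ σ)` for `σ ∈ P`, `(T ξ)(σ) = 0` otherwise, where `φ` is
injective on `P`. -/
def pullOp (P : Set (Conf d N)) (φ : Conf d N → Conf d N) (h : Set.InjOn φ P) : Op d N :=
  LinearMap.mkContinuous
    { toFun := fun ξ => ⟨pullFun P φ ξ, memℓp_gen' (sum_pullFun_le h ξ)⟩
      map_add' := fun ξ η => by
        ext σ
        change pullFun P φ (ξ + η) σ = pullFun P φ ξ σ + pullFun P φ η σ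
        unfold pullFun
        split_ifs <;> simp
      map_smul' := fun c ξ => by
        ext σ
        change pullFun P φ (c • ξ) σ = c • pullFun P φ ξ σ
        unfold pullFun
        split_ifs <;> simp }
    1 (fun ξ => by
      rw [one_mul]
      exact lp.norm_le_of_forall_sum_le (by norm_num) (norm_nonneg _) (sum_pullFun_le h ξ))

theorem pullOp_apply (P : Set (Conf d N)) (φ : Conf d N → Conf d N) (h : Set.InjOn φ P)
    (ξ : Hil d N) (σ : Conf d N) : (pullOp P φ h ξ) σ = pullFun P φ ξ σ := rfl

theorem injOn_update (x : Lattice d) (s t : Fin N) :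
    Set.InjOn (fun σ : Conf d N => Function.update σ x t) {σ | σ x = s} := by
  intro σ hσ τ hτ h
  funext y
  by_cases hy : y = x
  · subst hy
    exact Eq.trans hσ hτ.symm
  · have := congrFun h y
    simpa [Function.update_of_ne hy] using this

/-- The matrix `a` acting at the site `x`:
`(a_x ξ)(σ) = ∑ t, a (σ x) t * ξ (σ with t at x)`, see `siteOp_apply`. -/
def siteOp (x : Lattice d) (a : Matrix (Fin N) (Fin N) ℂ) : Op d N :=
  ∑ s, ∑ t, a s t •
    pullOp {σ : Conf d N | σ x = s} (fun σ => Function.update σ x t) (injOn_update x s t)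

theorem lp_sum_apply {ι : Type*} (s : Finset ι) (f : ι → Hil d N) (σ : Conf d N) :
    (∑ i ∈ s, f i : Hil d N) σ = ∑ i ∈ s, f i σ := by
  rw [lp.coeFn_sum, Finset.sum_apply]

theorem siteOp_apply (x : Lattice d) (a : Matrix (Fin N) (Fin N) ℂ) (ξ : Hil d N)
    (σ : Conf d N) :
    (siteOp x a ξ) σ = ∑ t, a (σ x) t * ξ (Function.update σ x t) := by
  simp only [siteOp, _root_.sum_apply, lp_sum_apply, _root_.smul_apply,
    lp.coeFn_smul, Pi.smul_apply, smul_eq_mul, pullOp_apply, pullFun, Set.mem_ofPred_eq]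
  rw [Finset.sum_comm]
  refine Finset.sum_congr rfl fun t _ => ?_
  simp

theorem injOn_shift (x : Lattice d) :
    Set.InjOn (fun (σ : Conf d N) z => σ (z + x)) Set.univ := by
  intro σ _ τ _ h
  funext y
  simpa using congrFun h (y - x)

/-- The translation operator `(U_x ξ)(σ) = ξ (σ(· + x))`. -/
def shiftOp (x : Lattice d) : Op d N :=
  pullOp Set.univ (fun σ z => σ (z + x)) (injOn_shift x)

theorem shiftOp_apply (x : Lattice d) (ξ : Hil d N) (σ : Conf d N) :
    (shiftOp x ξ) σ = ξ (fun z => σ (z + x)) := by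
  simp [shiftOp, pullOp_apply, pullFun]

theorem shiftOp_mul_neg (x : Lattice d) : (shiftOp x * shiftOp (-x) : Op d N) = 1 := by
  ext ξ σ
  simp [shiftOp_apply]

theorem shiftOp_neg_mul (x : Lattice d) : (shiftOp (-x) * shiftOp x : Op d N) = 1 := by
  simpa using shiftOp_mul_neg (N := N) (-x)

theorem star_shiftOp (x : Lattice d) : star (shiftOp x : Op d N) = shiftOp (-x) := by
  rw [ContinuousLinearMap.star_eq_adjoint]
  symm
  rw [ContinuousLinearMap.eq_adjoint_iff]
  intro ξ η
  rw [lp.inner_eq_tsum, lp.inner_eq_tsum]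
  let e : Conf d N ≃ Conf d N :=
    { toFun := fun σ z => σ (z + x)
      invFun := fun σ z => σ (z + -x)
      left_inv := fun σ => by funext z; simp
      right_inv := fun σ => by funext z; simp }
  rw [← e.tsum_eq]
  refine tsum_congr fun σ => ?_
  rw [shiftOp_apply, shiftOp_apply]
  have h : (fun z => e σ (z + -x)) = σ := by
    funext z
    simp [e]
  rw [h]
  rfl

/-- `U_x` as a unitary. -/
def shiftUnitary (x : Lattice d) : unitary (Op d N) :=
  ⟨shiftOp x, by
    rw [Unitary.mem_iff, star_shiftOp]
    exact ⟨shiftOp_neg_mul x, shiftOp_mul_neg x⟩⟩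

/-- The space translation `τ_x`, `τ_x(A) = U_x A U_x^*`, on all bounded operators. -/
def translateOp (x : Lattice d) : Op d N ≃⋆ₐ[ℂ] Op d N :=
  Unitary.conjStarAlgAut ℂ (Op d N) (shiftUnitary x)

theorem translateOp_apply (x : Lattice d) (A : Op d N) :
    translateOp x A = shiftOp x * A * shiftOp (-x) := by
  rw [← star_shiftOp]
  rfl

/-- `τ_x` moves an observable at `y` to the same observable at `y + x`. -/
theorem translateOp_siteOp (x y : Lattice d) (a : Matrix (Fin N) (Fin N) ℂ) :
    translateOp x (siteOp y a) = siteOp (y + x) a := by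
  rw [translateOp_apply]
  ext ξ σ
  simp only [mul_apply_eq_comp, shiftOp_apply, siteOp_apply]
  refine Finset.sum_congr rfl fun t _ => ?_
  have h : (fun z => Function.update (fun z => σ (z + x)) y t (z + -x))
      = Function.update σ (y + x) t := by
    funext z
    by_cases hz : z = y + x
    · subst hz
      simp
    · have hne : z + -x ≠ y := fun h => hz (by rw [← h]; simp)
      rw [Function.update_of_ne hne, Function.update_of_ne hz]
      simp
  rw [h]

end Operators

/-- `𝒪_R` for a region `R ⊆ ℤ^d` (finite or not): the `C*`-algebra generated by the observables
`a_x`, `a ∈ 𝒜`, `x ∈ R`.  For finite `R` it is `⨂_{x ∈ R} 𝒜`. -/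
def localAlg {N : ℕ} (d : ℕ) (𝒜 : StarSubalgebra ℂ (Matrix (Fin N) (Fin N) ℂ))
    (R : Set (Lattice d)) : StarSubalgebra ℂ (Op d N) :=
  (StarAlgebra.adjoin ℂ {T : Op d N | ∃ x ∈ R, ∃ a ∈ 𝒜, T = siteOp x a}).topologicalClosure

/-- The algebra of observables `𝒪` of the infinite system. -/
abbrev quasiLocal {N : ℕ} (d : ℕ) (𝒜 : StarSubalgebra ℂ (Matrix (Fin N) (Fin N) ℂ)) :
    StarSubalgebra ℂ (Op d N) :=
  localAlg d 𝒜 Set.univ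

section States

variable {d N : ℕ} {𝒜 : StarSubalgebra ℂ (Matrix (Fin N) (Fin N) ℂ)}

instance isClosed_localAlg (R : Set (Lattice d)) :
    IsClosed (localAlg d 𝒜 R : Set (Op d N)) :=
  StarSubalgebra.isClosed_topologicalClosure _

theorem translateOp_mem (x : Lattice d) {A : Op d N} (hA : A ∈ quasiLocal d 𝒜) :
    translateOp x A ∈ quasiLocal d 𝒜 := by
  have hc : Continuous fun A : Op d N => translateOp x A := by
    simp only [translateOp_apply]
    fun_prop
  have key : quasiLocal d 𝒜 ≤
      (quasiLocal d 𝒜).comap ((translateOp x : Op d N ≃⋆ₐ[ℂ] Op d N) : Op d N →⋆ₐ[ℂ] Op d N) := by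
    refine StarSubalgebra.topologicalClosure_minimal (StarAlgebra.adjoin_le ?_) ?_
    · rintro T ⟨y, -, a, ha, rfl⟩
      change translateOp x (siteOp y a) ∈ quasiLocal d 𝒜
      rw [translateOp_siteOp]
      exact StarSubalgebra.le_topologicalClosure _
        (StarAlgebra.subset_adjoin ℂ _ ⟨y + x, trivial, a, ha, rfl⟩)
    · exact (isClosed_localAlg (𝒜 := 𝒜) Set.univ).preimage hc
  exact key hA

/-- The space translation `τ_x` on `𝒪`. -/
def translate (x : Lattice d) (A : quasiLocal d 𝒜) : quasiLocal d 𝒜 :=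
  ⟨translateOp x A, translateOp_mem x A.2⟩

/-- A state: a positive normalized linear functional on `𝒪`. -/
def IsState (ω : quasiLocal d 𝒜 →ₗ[ℂ] ℂ) : Prop :=
  ω 1 = 1 ∧ ∀ A : quasiLocal d 𝒜, 0 ≤ (ω (star A * A)).re ∧ (ω (star A * A)).im = 0

/-- Invariance of a functional under all space translations. -/
def IsTranslationInvariant (ω : quasiLocal d 𝒜 →ₗ[ℂ] ℂ) : Prop :=
  ∀ (x : Lattice d) (A : quasiLocal d 𝒜), ω (translate x A) = ω A

/-- For `C(m) = {z ; a_i ≤ z_i < a_i + m}` this is `C^r(m)`, the concentric cube of side length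
`m + 2r`; `r = 0` gives `C(m)` itself. -/
def cube {d : ℕ} (a : Lattice d) (m r : ℕ) : Set (Lattice d) :=
  {z | ∀ i, a i - r ≤ z i ∧ z i < a i + m + r}

/-- `ω` is asymptotically decoupled (with some parameters `g`, `c`). -/
def AsymptoticallyDecoupled (ω : quasiLocal d 𝒜 →ₗ[ℂ] ℂ) : Prop :=
  ∃ (g : ℕ → ℕ) (c : ℕ → ℝ),
    Tendsto (fun m => (g m : ℝ) / m) atTop (𝓝 0) ∧
    (∀ m, 0 ≤ c m) ∧
    Tendsto (fun m : ℕ => c m / (m : ℝ) ^ d) atTop (𝓝 0) ∧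
    ∀ (m : ℕ) (a : Lattice d) (A B : quasiLocal d 𝒜),
      (A : Op d N) ∈ localAlg d 𝒜 (cube a m 0) → (A : Op d N).IsPositive →
      (B : Op d N) ∈ localAlg d 𝒜 (cube a m (g m))ᶜ → (B : Op d N).IsPositive →
      Real.exp (-c m) * (ω A).re * (ω B).re ≤ (ω (A * B)).re ∧
        (ω (A * B)).re ≤ Real.exp (c m) * (ω A).re * (ω B).re

/-- The spectral projection `I_A(H)` of `H` for the Borel set `A ⊆ ℝ`, as the continuous functional
calculus of the indicator function of `A`.  It is used for self-adjoint elements `H` of some `𝒪_Λ`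
with `Λ` finite: they have finite spectrum, so the indicator is continuous on it and `I_A(H)` is
the sum of the eigenprojections of `H` for the eigenvalues in `A`. -/
def spectralProjection (A : Set ℝ) (H : quasiLocal d 𝒜) : quasiLocal d 𝒜 :=
  cfc (A.indicator (fun _ => (1 : ℝ))) H

end States

/-! ### Interactions -/

/-- A translation invariant interaction. -/
structure Interaction {N : ℕ} (d : ℕ) (𝒜 : StarSubalgebra ℂ (Matrix (Fin N) (Fin N) ℂ)) where
  ψ : Finset (Lattice d) → quasiLocal d 𝒜
  isSelfAdjoint : ∀ X, IsSelfAdjoint (ψ X)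
  mem_localAlg : ∀ X : Finset (Lattice d), (ψ X : Op d N) ∈ localAlg d 𝒜 (X : Set (Lattice d))
  translate_eq : ∀ (x : Lattice d) (X : Finset (Lattice d)),
    translate x (ψ X) = ψ (X.map (addRightEmbedding x))

namespace Interaction

variable {d N : ℕ} {𝒜 : StarSubalgebra ℂ (Matrix (Fin N) (Fin N) ℂ)}

/-- `‖Ψ‖ = ∑_{X ∋ 0} |X|⁻¹ ‖ψ_X‖` is finite. -/
def FiniteNorm (Ψ : Interaction d 𝒜) : Prop :=
  Summable fun X : {X : Finset (Lattice d) // (0 : Lattice d) ∈ X} =>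
    ((X : Finset (Lattice d)).card : ℝ)⁻¹ * ‖Ψ.ψ X‖

/-- `Ψ` is classical: all its terms lie in the classical `C*`-algebra `𝒪^(cl)` that is built from
some abelian subalgebra `𝒞` of the one-site algebra. -/
def IsClassical (Ψ : Interaction d 𝒜) : Prop :=
  ∃ 𝒞 : StarSubalgebra ℂ (Matrix (Fin N) (Fin N) ℂ), 𝒞 ≤ 𝒜 ∧
    (∀ a ∈ 𝒞, ∀ b ∈ 𝒞, a * b = b * a) ∧
    ∀ X, (Ψ.ψ X : Op d N) ∈ quasiLocal d 𝒞

/-- The Hamiltonian `K_Λ = ∑_{X ⊆ Λ} ψ_X`. -/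
def K (Ψ : Interaction d 𝒜) (Λ : Finset (Lattice d)) : quasiLocal d 𝒜 :=
  ∑ X ∈ Λ.powerset, Ψ.ψ X

end Interaction

/-- The cube `Λ(n) = {z ; 0 ≤ z_i ≤ n - 1}`. -/
def box (d n : ℕ) : Finset (Lattice d) := Fintype.piFinset fun _ => Finset.Ico (0 : ℤ) n

end QuantumSpin

end

namespace QuantumSpin

/-! ### Large deviations for compactly supported measures that split into almost independent copies -/

/-! The argument is of Ruelle–Lanford type. A height r is admissible at x if every ball around x
eventually has mass at least exp(-v_n (r + δ)), for every δ > 0; the admissible pairs form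
`rateEpigraph`. All of the probability follows from one superadditivity property, `DominatesCopies`:
the mass of μ_n near a weighted mean of x and y is at least a product of masses of μ_m near x and
near y, up to a factor exp(-v_n η). Filling the system with copies of one good block turns "for
infinitely many n" into "for all large n" (`mem_rateEpigraph_of_frequently`), and mixing two kinds
of blocks gives convexity (`convex_rateEpigraph`).

A point outside the epigraph therefore has an eventual exponential upper bound on some ball. A
finite cover of the common compact support then gives both the upper bound on closed sets and the
limit of the logarithmic moment generating function (`eventually_setLIntegral_exp_le`). The epigraph
being closed and convex, Hahn–Banach recovers it from its Legendre transform
(`exists_lt_sub_rateLegendre`).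

The quantum input is `dominatesCopies_of_decoupled`. In well separated cubes of side m, let P be the
product of the spectral projections that fix the block energy densities. Decoupling and translation
invariance bound ω(P) below by a product of one-block probabilities. Classicality makes P commute
with the energy of the large cube, so P lies below a spectral projection of that energy as soon as
P(H - y) has small norm (`mul_specProj_eq_self`). It is small because the interaction norm per site
inside a cube converges (`FiniteNorm.tendsto_totalNorm_div`): the terms contained in no block are
negligible per site. -/

theorem one_div_mul_log_le {v c : ℝ} (hv : 0 < v) {m : ℝ≥0∞}
    (h : m ≤ ENNReal.ofReal (Real.exp (v * c))) :
    ((1 / v : ℝ) : EReal) * ENNReal.log m ≤ (c : EReal) := by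
  have h1 : ENNReal.log m ≤ ((v * c : ℝ) : EReal) := by
    refine (ENNReal.log_monotone h).trans ?_
    rw [ENNReal.log_ofReal_of_pos (Real.exp_pos _), Real.log_exp]
  calc ((1 / v : ℝ) : EReal) * ENNReal.log m
      ≤ ((1 / v : ℝ) : EReal) * ((v * c : ℝ) : EReal) := by
        refine mul_le_mul_of_nonneg_left h1 ?_
        exact_mod_cast (by positivity : (0 : ℝ) ≤ 1 / v)
    _ = (c : EReal) := by
        rw [← EReal.coe_mul]
        congr 1
        field_simp

theorem le_one_div_mul_log {v c : ℝ} (hv : 0 < v) {m : ℝ≥0∞}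
    (h : ENNReal.ofReal (Real.exp (v * c)) ≤ m) :
    (c : EReal) ≤ ((1 / v : ℝ) : EReal) * ENNReal.log m := by
  have h1 : ((v * c : ℝ) : EReal) ≤ ENNReal.log m := by
    refine le_trans (le_of_eq ?_) (ENNReal.log_monotone h)
    rw [ENNReal.log_ofReal_of_pos (Real.exp_pos _), Real.log_exp]
  calc (c : EReal) = ((1 / v : ℝ) : EReal) * ((v * c : ℝ) : EReal) := by
        rw [← EReal.coe_mul]
        congr 1
        field_simp
    _ ≤ _ := by
        refine mul_le_mul_of_nonneg_left h1 ?_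
        exact_mod_cast (by positivity : (0 : ℝ) ≤ 1 / v)

theorem eventually_le_exp_mul {v : ℕ → ℝ} (hv : Tendsto v atTop atTop) (K : ℝ) {δ : ℝ}
    (hδ : 0 < δ) : ∀ᶠ n in atTop, K ≤ Real.exp (v n * δ) :=
  (Real.tendsto_exp_atTop.comp (hv.atTop_mul_const hδ)).eventually_ge_atTop K

/-- The epigraph of the (lower) Ruelle–Lanford rate function of the measures `μ n` on the
scale `v n`. -/
def rateEpigraph (μ : ℕ → Measure ℝ) (v : ℕ → ℝ) : Set (ℝ × ℝ) :=
  {p | ∀ ε > 0, ∀ δ > 0, ∀ᶠ n in atTop,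
    Real.exp (-(v n * (p.2 + δ))) ≤ (μ n).real (Metric.ball p.1 ε)}

/-- The law `μ n` dominates, up to subexponential factors, the law of the empirical mean of
`q m n` independent variables with law `μ m`, on configurations with at most two values. -/
structure DominatesCopies (μ : ℕ → Measure ℝ) (v : ℕ → ℝ) (q : ℕ → ℕ → ℕ) : Prop where
  tendsto_copies : ∀ᶠ m in atTop, Tendsto (q m) atTop atTop
  mul_scale_le : ∀ m n, q m n * v m ≤ v n
  prod_le : ∀ x y : ℝ, ∀ ε > 0, ∀ η > 0, ∀ᶠ m in atTop, ∀ᶠ n in atTop, ∀ k ≤ q m n,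
    Real.exp (-(v n * η)) * ((μ m).real (Metric.ball x ε) ^ k *
      (μ m).real (Metric.ball y ε) ^ (q m n - k)) ≤
      (μ n).real (Metric.ball ((k * x + (q m n - k : ℕ) * y) / q m n) (ε + η))

section RateEpigraph

variable {μ : ℕ → Measure ℝ} {v : ℕ → ℝ} {M : ℝ}

/-- A negative height would force a probability above 1. Only frequent bounds are assumed, so that
the lemma is available before frequent and eventual bounds are known to agree. -/
theorem rateEpigraph_nonneg [∀ n, IsProbabilityMeasure (μ n)] (hv : Tendsto v atTop atTop)
    {x r : ℝ}
    (h : ∀ ε > 0, ∀ δ > 0, ∃ᶠ n in atTop,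
      Real.exp (-(v n * (r + δ))) ≤ (μ n).real (Metric.ball x ε)) : 0 ≤ r := by
  by_contra! hr
  have h1 := h 1 one_pos (-r / 2) (by linarith)
  obtain ⟨n, hn, hn'⟩ := (h1.and_eventually (hv.eventually_gt_atTop 0)).exists
  have h2 : (μ n).real (Metric.ball x 1) ≤ 1 := measureReal_le_one
  have h3 : 1 < Real.exp (-(v n * (r + -r / 2))) := by
    rw [Real.one_lt_exp_iff]
    nlinarith
  linarith

theorem rateEpigraph_mono (hv : Tendsto v atTop atTop) {x r r' : ℝ} (h : r ≤ r')
    (hx : (x, r) ∈ rateEpigraph μ v) : (x, r') ∈ rateEpigraph μ v := by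
  intro ε hε δ hδ
  filter_upwards [hx ε hε δ hδ, hv.eventually_ge_atTop 0] with n hn hn'
  refine le_trans (Real.exp_le_exp.2 ?_) hn
  nlinarith

theorem abs_le_of_mem_rateEpigraph (hM : ∀ᶠ n in atTop, μ n (Set.Icc (-M) M)ᶜ = 0) {x r : ℝ}
    (hx : (x, r) ∈ rateEpigraph μ v) : |x| ≤ M := by
  by_contra! h
  obtain ⟨n, hn, hn'⟩ := ((hx (|x| - M) (by linarith) 1 one_pos).and hM).exists
  have h0 : (μ n).real (Metric.ball x (|x| - M)) = 0 := by
    rw [Measure.real, measure_mono_null _ hn', ENNReal.toReal_zero]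
    intro y hy hy'
    rw [Metric.mem_ball, Real.dist_eq] at hy
    have h1 : |y| ≤ M := abs_le.2 hy'
    have h2 := abs_sub_abs_le_abs_sub x y
    rw [abs_sub_comm] at h2
    linarith
  simp only at hn
  rw [h0] at hn
  exact absurd hn (not_le.2 (Real.exp_pos _))

/-- The tolerances ε and δ in the definition absorb a small displacement of the point and of the
height. -/
theorem isClosed_rateEpigraph [∀ n, IsProbabilityMeasure (μ n)] (hv : Tendsto v atTop atTop) :
    IsClosed (rateEpigraph μ v) := by
  refine isClosed_of_closure_subset fun p hp ε hε δ hδ => ?_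
  obtain ⟨p', hp', hd⟩ := Metric.mem_closure_iff.1 hp (min (ε / 2) (δ / 2)) (by positivity)
  rw [Prod.dist_eq, max_lt_iff, lt_min_iff, lt_min_iff] at hd
  filter_upwards [hp' (ε / 2) (half_pos hε) (δ / 2) (half_pos hδ),
    hv.eventually_ge_atTop 0] with n hn hn'
  have h2 : p'.2 ≤ p.2 + δ / 2 := by
    have := hd.2.2
    rw [Real.dist_eq] at this
    linarith [neg_abs_le (p.2 - p'.2)]
  calc Real.exp (-(v n * (p.2 + δ))) ≤ Real.exp (-(v n * (p'.2 + δ / 2))) := by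
        refine Real.exp_le_exp.2 ?_
        nlinarith
    _ ≤ _ := hn
    _ ≤ _ := by
        refine measureReal_mono (Metric.ball_subset_ball' ?_)
        have := hd.1.1
        rw [dist_comm] at this
        linarith

variable {q : ℕ → ℕ → ℕ}

/-- One good scale m suffices: all larger systems are filled with copies of it. Hence the upper and
lower rate functions coincide, which is what makes a full large deviation principle possible. -/
theorem mem_rateEpigraph_of_frequently [∀ n, IsProbabilityMeasure (μ n)]
    (hv : Tendsto v atTop atTop) (H : DominatesCopies μ v q) {x r : ℝ}
    (h : ∀ ε > 0, ∀ δ > 0, ∃ᶠ n in atTop,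
      Real.exp (-(v n * (r + δ))) ≤ (μ n).real (Metric.ball x ε)) :
    (x, r) ∈ rateEpigraph μ v := by
  have hr : 0 ≤ r := rateEpigraph_nonneg hv h
  intro ε hε δ hδ
  set η := min (ε / 2) (δ / 2) with hη
  have hη0 : 0 < η := by positivity
  obtain ⟨m, hm, hm', hq⟩ := ((h (ε / 2) (half_pos hε) (δ / 2) (half_pos hδ)).and_eventually
    ((H.prod_le x x (ε / 2) (half_pos hε) η hη0).and H.tendsto_copies)).exists
  filter_upwards [hm', hq.eventually_ge_atTop 1, hv.eventually_ge_atTop 0] with n hn hqn hvn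
  -- All copies take the value x, so the mean is again x.
  have h1 := hn (q m n) le_rfl
  rw [Nat.sub_self, pow_zero, mul_one] at h1
  have hq0 : (q m n : ℝ) ≠ 0 := by
    have : q m n ≠ 0 := by omega
    exact_mod_cast this
  have hx : ((q m n : ℝ) * x + (0 : ℕ) * x) / q m n = x := by
    rw [Nat.cast_zero, zero_mul, add_zero, mul_div_cancel_left₀ _ hq0]
  rw [hx] at h1
  calc Real.exp (-(v n * (r + δ)))
      ≤ Real.exp (-(v n * η)) * Real.exp (-(v m * (r + δ / 2))) ^ q m n := by
        rw [← Real.exp_nat_mul, ← Real.exp_add]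
        refine Real.exp_le_exp.2 ?_
        have h2 := H.mul_scale_le m n
        -- The copies fill only part of the system; since r ≥ 0, replacing their total scale by v n
        -- only weakens the bound.
        have h3 : q m n * v m * (r + δ / 2) ≤ v n * (r + δ / 2) :=
          mul_le_mul_of_nonneg_right h2 (by positivity)
        have h4 : v n * η ≤ v n * (δ / 2) := mul_le_mul_of_nonneg_left (min_le_right _ _) hvn
        nlinarith
    _ ≤ Real.exp (-(v n * η)) * (μ m).real (Metric.ball x (ε / 2)) ^ q m n := by gcongr
    _ ≤ _ := h1
    _ ≤ (μ n).real (Metric.ball x ε) := by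
        refine measureReal_mono (Metric.ball_subset_ball ?_)
        have := min_le_left (ε / 2) (δ / 2)
        linarith

/-- A fraction a of the blocks is given the value x and the rest the value y: means and exponential
costs both combine linearly. -/
theorem convex_rateEpigraph [∀ n, IsProbabilityMeasure (μ n)]
    (hv : Tendsto v atTop atTop) (H : DominatesCopies μ v q) :
    Convex ℝ (rateEpigraph μ v) := by
  rintro ⟨x, r⟩ hx ⟨y, s⟩ hy a b ha hb hab ε hε δ hδ
  have hr : 0 ≤ r := rateEpigraph_nonneg hv fun ε hε δ hδ => (hx ε hε δ hδ).frequently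
  have hs : 0 ≤ s := rateEpigraph_nonneg hv fun ε hε δ hδ => (hy ε hε δ hδ).frequently
  simp only [Prod.smul_mk, smul_eq_mul, Prod.mk_add_mk]
  set η := min (ε / 4) (δ / 4) with hη
  have hη0 : 0 < η := by positivity
  have hηε : η ≤ ε / 4 := min_le_left _ _
  have hηδ : η ≤ δ / 4 := min_le_right _ _
  obtain ⟨m, hm1, hm2, hm', hq, hvm⟩ :=
    ((hx (ε / 2) (half_pos hε) (δ / 2) (half_pos hδ)).and
    ((hy (ε / 2) (half_pos hε) (δ / 2) (half_pos hδ)).and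
    ((H.prod_le x y (ε / 2) (half_pos hε) η hη0).and
      (H.tendsto_copies.and (hv.eventually_ge_atTop 0))))).exists
  have hqr : Tendsto (fun n => (q m n : ℝ)) atTop atTop :=
    tendsto_natCast_atTop_atTop.comp hq
  -- The last two thresholds pay for rounding a * Q down to an integer: it moves the mean by at most
  -- |x - y| / Q ≤ ε / 4, and it adds at most one block of cost v m * (s + δ / 2) ≤ v n * (δ / 4).
  filter_upwards [hm', hq.eventually_ge_atTop 1, hv.eventually_ge_atTop 0,
    hqr.eventually_ge_atTop (|x - y| * 4 / ε),
    hv.eventually_ge_atTop (v m * (s + δ / 2) * 4 / δ)] with n hn hqn hvn hqn' hvn'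
  set Q := q m n with hQ
  have hQ0 : (0 : ℝ) < Q := by exact_mod_cast hqn
  set k := ⌊a * Q⌋₊ with hk
  have hk1 : (k : ℝ) ≤ a * Q := Nat.floor_le (by positivity)
  have hk2 : a * Q < k + 1 := Nat.lt_floor_add_one _
  have hkQ : k ≤ Q := by
    have : (k : ℝ) ≤ Q := by nlinarith
    exact_mod_cast this
  have h1 := hn k hkQ
  have hcast : ((Q - k : ℕ) : ℝ) = Q - k := Nat.cast_sub hkQ
  have hb' : b = 1 - a := by linarith
  calc Real.exp (-(v n * (a * r + b * s + δ)))
      ≤ Real.exp (-(v n * η)) * (Real.exp (-(v m * (r + δ / 2))) ^ k *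
          Real.exp (-(v m * (s + δ / 2))) ^ (Q - k)) := by
        rw [← Real.exp_nat_mul, ← Real.exp_nat_mul, ← Real.exp_add, ← Real.exp_add, hcast]
        refine Real.exp_le_exp.2 ?_
        have h2 := H.mul_scale_le m n
        rw [← hQ] at h2
        have e1 : (k : ℝ) * v m * (r + δ / 2) ≤ a * v n * (r + δ / 2) := by
          refine mul_le_mul_of_nonneg_right ?_ (by positivity)
          calc (k : ℝ) * v m ≤ a * Q * v m := by gcongr
            _ = a * (Q * v m) := by ring
            _ ≤ _ := by gcongr
        have e2 : ((Q : ℝ) - k) * v m * (s + δ / 2) ≤ (b * v n + v m) * (s + δ / 2) := by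
          refine mul_le_mul_of_nonneg_right ?_ (by positivity)
          calc ((Q : ℝ) - k) * v m ≤ (b * Q + 1) * v m := by
                refine mul_le_mul_of_nonneg_right ?_ hvm
                rw [hb']
                linarith
            _ = b * (Q * v m) + v m := by ring
            _ ≤ _ := by gcongr
        have e3 : v m * (s + δ / 2) ≤ v n * (δ / 4) := by
          rw [div_le_iff₀ hδ] at hvn'
          linarith
        have e4 : v n * η ≤ v n * (δ / 4) := mul_le_mul_of_nonneg_left hηδ hvn
        have e5 : a * v n * (r + δ / 2) + b * v n * (s + δ / 2)
            = v n * (a * r + b * s) + v n * (δ / 2) := by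
          rw [hb']
          ring
        nlinarith
    _ ≤ Real.exp (-(v n * η)) * ((μ m).real (Metric.ball x (ε / 2)) ^ k *
          (μ m).real (Metric.ball y (ε / 2)) ^ (Q - k)) := by gcongr
    _ ≤ _ := h1
    _ ≤ (μ n).real (Metric.ball (a * x + b * y) ε) := by
        refine measureReal_mono (Metric.ball_subset_ball' ?_)
        have e : (k * x + ((Q - k : ℕ) : ℝ) * y) / Q - (a * x + b * y)
            = (k - a * Q) / Q * (x - y) := by
          rw [hcast, hb']
          field_simp
          ring
        have e1 : |((k : ℝ) - a * Q) / Q| ≤ 1 / Q := by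
          rw [abs_div, abs_of_pos hQ0]
          gcongr
          rw [abs_le]
          constructor <;> linarith
        rw [Real.dist_eq, e, abs_mul]
        have e2 : 1 / (Q : ℝ) * |x - y| ≤ ε / 4 := by
          rw [div_le_iff₀ hε] at hqn'
          rw [one_div, inv_mul_le_iff₀ hQ0]
          linarith
        have e3 := mul_le_mul_of_nonneg_right e1 (abs_nonneg (x - y))
        linarith

/-- Exponential bound of the tilted measures on a closed set none of whose points, with the
height given by `α` and `t`, is in the epigraph. -/
theorem eventually_setLIntegral_exp_le [∀ n, IsProbabilityMeasure (μ n)]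
    (hv : Tendsto v atTop atTop) (hM : ∀ᶠ n in atTop, μ n (Set.Icc (-M) M)ᶜ = 0)
    (H : DominatesCopies μ v q) {C : Set ℝ} (hC : IsClosed C) {α t : ℝ}
    (h : ∀ x ∈ C, (x, α * x - t) ∉ rateEpigraph μ v) :
    ∃ K : ℕ, ∀ᶠ n in atTop, ∫⁻ x in C, ENNReal.ofReal (Real.exp (v n * (α * x))) ∂(μ n)
      ≤ K * ENNReal.ofReal (Real.exp (v n * t)) := by
  have hcomp : IsCompact (Set.Icc (-M) M ∩ C) := isCompact_Icc.inter_right hC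
  suffices hs : ∃ K : ℕ, ∀ᶠ n in atTop,
      ∫⁻ x in Set.Icc (-M) M ∩ C, ENNReal.ofReal (Real.exp (v n * (α * x))) ∂(μ n)
        ≤ K * ENNReal.ofReal (Real.exp (v n * t)) by
    obtain ⟨K, hK⟩ := hs
    refine ⟨K, ?_⟩
    filter_upwards [hK, hM] with n hn hMn
    refine le_trans ?_ hn
    have hsub : C ⊆ (Set.Icc (-M) M ∩ C) ∪ (Set.Icc (-M) M)ᶜ := by
      intro x hx
      by_cases hx' : x ∈ Set.Icc (-M) M
      · exact Or.inl ⟨hx', hx⟩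
      · exact Or.inr hx'
    refine (lintegral_mono_set hsub).trans ((lintegral_union_le _ _ _).trans ?_)
    rw [setLIntegral_measure_zero _ _ hMn, add_zero]
  refine hcomp.induction_on (p := fun s => ∃ K : ℕ, ∀ᶠ n in atTop,
      ∫⁻ x in s, ENNReal.ofReal (Real.exp (v n * (α * x))) ∂(μ n)
        ≤ K * ENNReal.ofReal (Real.exp (v n * t))) ⟨0, by simp⟩ ?_ ?_ ?_
  · rintro s s' hss ⟨K, hK⟩
    exact ⟨K, hK.mono fun n hn => (lintegral_mono_set hss).trans hn⟩
  · rintro s s' ⟨K, hK⟩ ⟨K', hK'⟩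
    refine ⟨K + K', ?_⟩
    filter_upwards [hK, hK'] with n hn hn'
    refine (lintegral_union_le _ _ _).trans ((add_le_add hn hn').trans (le_of_eq ?_))
    push_cast
    ring
  · rintro x ⟨-, hx⟩
    -- Even the frequent lower bound fails at x, so its negation is an upper bound valid for all
    -- large n on one fixed ball.
    have h1 : ¬ ∀ ε > 0, ∀ δ > 0, ∃ᶠ n in atTop,
        Real.exp (-(v n * (α * x - t + δ))) ≤ (μ n).real (Metric.ball x ε) :=
      fun h' => h x hx (mem_rateEpigraph_of_frequently hv H h')
    push Not at h1
    obtain ⟨ε, hε, δ, hδ, h2⟩ := h1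
    -- On this smaller ball the tilt α * y exceeds α * x by at most δ, exactly the gain in the
    -- measure bound.
    set ρ := min ε (δ / (|α| + 1)) with hρ
    have hρ0 : 0 < ρ := by positivity
    refine ⟨Metric.ball x ρ, mem_nhdsWithin_of_mem_nhds (Metric.ball_mem_nhds x hρ0), 1, ?_⟩
    filter_upwards [h2, hv.eventually_ge_atTop 0] with n hn hvn
    rw [Nat.cast_one, one_mul]
    have hαρ : |α| * ρ ≤ δ := by
      have : ρ ≤ δ / (|α| + 1) := min_le_right _ _
      rw [le_div_iff₀ (by positivity)] at this
      nlinarith [abs_nonneg α]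
    calc ∫⁻ y in Metric.ball x ρ, ENNReal.ofReal (Real.exp (v n * (α * y))) ∂(μ n)
        ≤ ∫⁻ y in Metric.ball x ρ, ENNReal.ofReal (Real.exp (v n * (α * x + δ))) ∂(μ n) := by
          refine setLIntegral_mono measurable_const fun y hy => ?_
          gcongr
          rw [Metric.mem_ball, Real.dist_eq] at hy
          have h3 : α * (y - x) ≤ |α| * |y - x| := by
            rw [← abs_mul]
            exact le_abs_self _
          have h4 : |α| * |y - x| ≤ |α| * ρ := by gcongr
          linarith
      _ = ENNReal.ofReal (Real.exp (v n * (α * x + δ))) * μ n (Metric.ball x ρ) := by simp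
      _ ≤ ENNReal.ofReal (Real.exp (v n * (α * x + δ))) *
            ENNReal.ofReal (Real.exp (-(v n * (α * x - t + δ)))) := by
          gcongr
          rw [← ofReal_measureReal]
          refine ENNReal.ofReal_le_ofReal (le_trans ?_ hn.le)
          exact measureReal_mono (Metric.ball_subset_ball (min_le_left _ _))
      _ = ENNReal.ofReal (Real.exp (v n * t)) := by
          rw [← ENNReal.ofReal_mul (Real.exp_pos _).le, ← Real.exp_add]
          congr 2
          ring

/-- The untilted case α = 0; the constant from the finite cover is absorbed by exp(v n * δ). -/
theorem eventually_measure_le [∀ n, IsProbabilityMeasure (μ n)]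
    (hv : Tendsto v atTop atTop) (hM : ∀ᶠ n in atTop, μ n (Set.Icc (-M) M)ᶜ = 0)
    (H : DominatesCopies μ v q) {C : Set ℝ} (hC : IsClosed C) {r : ℝ}
    (h : ∀ x ∈ C, (x, r) ∉ rateEpigraph μ v) {δ : ℝ} (hδ : 0 < δ) :
    ∀ᶠ n in atTop, μ n C ≤ ENNReal.ofReal (Real.exp (v n * (-r + δ))) := by
  obtain ⟨K, hK⟩ := eventually_setLIntegral_exp_le (α := 0) (t := -r) hv hM H hC
    (by simpa using h)
  filter_upwards [hK, eventually_le_exp_mul hv K hδ] with n hn hn'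
  simp only [zero_mul, mul_zero, Real.exp_zero, ENNReal.ofReal_one, lintegral_const,
    Measure.restrict_apply MeasurableSet.univ, Set.univ_inter, one_mul] at hn
  refine hn.trans ?_
  rw [← ENNReal.ofReal_natCast, ← ENNReal.ofReal_mul (Nat.cast_nonneg _)]
  refine ENNReal.ofReal_le_ofReal ?_
  rw [mul_add, Real.exp_add, mul_comm]
  gcongr

theorem rateEpigraph_nonempty [∀ n, IsProbabilityMeasure (μ n)]
    (hv : Tendsto v atTop atTop) (hM : ∀ᶠ n in atTop, μ n (Set.Icc (-M) M)ᶜ = 0)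
    (H : DominatesCopies μ v q) : (rateEpigraph μ v).Nonempty := by
  by_contra! h
  -- With an empty epigraph the whole line would have measure at most exp(-v n), that is exp(v n *
  -- (-2 + 1)).
  have h1 := eventually_measure_le hv hM H isClosed_univ (r := 2)
    (fun x _ => by rw [h]; exact Set.notMem_empty _) one_pos
  obtain ⟨n, hn, hn'⟩ := (h1.and (hv.eventually_gt_atTop 0)).exists
  rw [measure_univ, ENNReal.one_le_ofReal, Real.one_le_exp_iff] at hn
  linarith

/-- The logarithmic moment generating function as the Legendre transform of the rate function. -/
noncomputable def rateLegendre (μ : ℕ → Measure ℝ) (v : ℕ → ℝ) (α : ℝ) : ℝ :=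
  sSup ((fun p : ℝ × ℝ => α * p.1 - p.2) '' rateEpigraph μ v)

theorem bddAbove_rateLegendre [∀ n, IsProbabilityMeasure (μ n)]
    (hv : Tendsto v atTop atTop) (hM : ∀ᶠ n in atTop, μ n (Set.Icc (-M) M)ᶜ = 0) (α : ℝ) :
    BddAbove ((fun p : ℝ × ℝ => α * p.1 - p.2) '' rateEpigraph μ v) := by
  refine ⟨|α| * M, ?_⟩
  rintro _ ⟨⟨x, r⟩, hx, rfl⟩
  have hr : 0 ≤ r := rateEpigraph_nonneg hv fun ε hε δ hδ => (hx ε hε δ hδ).frequently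
  have h1 : |α| * |x| ≤ |α| * M := by
    gcongr
    exact abs_le_of_mem_rateEpigraph hM hx
  have h2 : α * x ≤ |α| * |x| := by
    rw [← abs_mul]
    exact le_abs_self _
  linarith

theorem le_rateLegendre [∀ n, IsProbabilityMeasure (μ n)]
    (hv : Tendsto v atTop atTop) (hM : ∀ᶠ n in atTop, μ n (Set.Icc (-M) M)ᶜ = 0) (α : ℝ)
    {x r : ℝ} (h : (x, r) ∈ rateEpigraph μ v) : α * x - r ≤ rateLegendre μ v α :=
  le_csSup (bddAbove_rateLegendre hv hM α) ⟨(x, r), h, rfl⟩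

theorem integrable_exp_of_measure_compl_Icc {ν : Measure ℝ} [IsProbabilityMeasure ν]
    (hν : ν (Set.Icc (-M) M)ᶜ = 0) (c : ℝ) : Integrable (fun x => Real.exp (c * x)) ν := by
  refine Integrable.of_bound (by fun_prop) (Real.exp (|c| * M)) ?_
  have : ∀ᵐ x ∂ν, x ∈ Set.Icc (-M) M := by rwa [ae_iff]
  filter_upwards [this] with x hx
  rw [Real.norm_eq_abs, Real.abs_exp, Real.exp_le_exp]
  have h1 : |x| ≤ M := abs_le.2 hx
  calc c * x ≤ |c| * |x| := by
        rw [← abs_mul]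
        exact le_abs_self _
    _ ≤ _ := by gcongr

/-- Laplace's principle: one nearly optimal point of the epigraph gives the lower bound, and the
tilted covering estimate on the whole line gives the upper bound. -/
theorem tendsto_log_integral_exp [∀ n, IsProbabilityMeasure (μ n)]
    (hv : Tendsto v atTop atTop) (hM : ∀ᶠ n in atTop, μ n (Set.Icc (-M) M)ᶜ = 0)
    (H : DominatesCopies μ v q) (α : ℝ) :
    Tendsto (fun n => 1 / v n * Real.log (∫ x, Real.exp (α * v n * x) ∂(μ n))) atTop
      (𝓝 (rateLegendre μ v α)) := by
  have hint : ∀ᶠ n in atTop, Integrable (fun x => Real.exp (α * v n * x)) (μ n) :=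
    hM.mono fun n hn => integrable_exp_of_measure_compl_Icc hn _
  have key : ∀ η > 0, ∀ᶠ n in atTop,
      rateLegendre μ v α - η ≤ 1 / v n * Real.log (∫ x, Real.exp (α * v n * x) ∂(μ n)) ∧
      1 / v n * Real.log (∫ x, Real.exp (α * v n * x) ∂(μ n)) ≤ rateLegendre μ v α + η := by
    intro η hη
    have hlow : ∀ᶠ n in atTop, Real.exp (v n * (rateLegendre μ v α - η)) ≤
        ∫ x, Real.exp (α * v n * x) ∂(μ n) := by
      have hne : ((fun p : ℝ × ℝ => α * p.1 - p.2) '' rateEpigraph μ v).Nonempty :=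
        (rateEpigraph_nonempty hv hM H).image _
      obtain ⟨_, ⟨⟨x, r⟩, hx, rfl⟩, hxr⟩ :=
        exists_lt_of_lt_csSup hne (show rateLegendre μ v α - η / 2 < _ by
          unfold rateLegendre
          linarith)
      set ρ := η / 4 / (|α| + 1) with hρ
      have hρ0 : 0 < ρ := by positivity
      have hαρ : |α| * ρ ≤ η / 4 := by
        have : ρ * (|α| + 1) = η / 4 := by
          rw [hρ]
          field_simp
        nlinarith
      filter_upwards [hx ρ hρ0 (η / 4) (by positivity), hv.eventually_ge_atTop 0, hint]
        with n hn hvn hin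
      calc Real.exp (v n * (rateLegendre μ v α - η))
          ≤ Real.exp (v n * (α * x - η / 4)) * Real.exp (-(v n * (r + η / 4))) := by
            rw [← Real.exp_add]
            refine Real.exp_le_exp.2 ?_
            nlinarith
        _ ≤ Real.exp (v n * (α * x - η / 4)) * (μ n).real (Metric.ball x ρ) := by gcongr
        _ = ∫ y in Metric.ball x ρ, Real.exp (v n * (α * x - η / 4)) ∂(μ n) := by
            simp [mul_comm]
        _ ≤ ∫ y in Metric.ball x ρ, Real.exp (α * v n * y) ∂(μ n) := by
            refine setIntegral_mono_on (integrable_const _).integrableOn hin.integrableOn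
              measurableSet_ball fun y hy => Real.exp_le_exp.2 ?_
            rw [Metric.mem_ball, Real.dist_eq] at hy
            have h3 : -(α * (y - x)) ≤ |α| * |y - x| := by
              rw [← abs_mul]
              exact neg_le_abs _
            have h4 : |α| * |y - x| ≤ |α| * ρ := by gcongr
            nlinarith
        _ ≤ _ := setIntegral_le_integral hin (Eventually.of_forall fun y => (Real.exp_pos _).le)
    have hup : ∀ᶠ n in atTop, ∫ x, Real.exp (α * v n * x) ∂(μ n) ≤
        Real.exp (v n * (rateLegendre μ v α + η)) := by
      -- If (x, α * x - t) were in the epigraph, then t would be at most the Legendre transform,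
      -- which it exceeds by η / 2.
      obtain ⟨K, hK⟩ := eventually_setLIntegral_exp_le (α := α)
        (t := rateLegendre μ v α + η / 2) hv hM H isClosed_univ (fun x _ hx => by
          have := le_rateLegendre hv hM α hx
          linarith)
      filter_upwards [hK, hint, eventually_le_exp_mul hv K (half_pos hη)] with n hn hin hKn
      rw [← ENNReal.ofReal_le_ofReal_iff (Real.exp_pos _).le,
        ofReal_integral_eq_lintegral_ofReal hin
          (Eventually.of_forall fun y => (Real.exp_pos _).le)]
      rw [setLIntegral_univ] at hn
      have e : ∀ x, α * v n * x = v n * (α * x) := fun x => by ring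
      simp only [e]
      refine hn.trans ?_
      rw [← ENNReal.ofReal_natCast, ← ENNReal.ofReal_mul (Nat.cast_nonneg _)]
      refine ENNReal.ofReal_le_ofReal ?_
      have : v n * (rateLegendre μ v α + η)
        = v n * (rateLegendre μ v α + η / 2) + v n * (η / 2) := by ring
      rw [this, Real.exp_add, mul_comm]
      gcongr
    filter_upwards [hlow, hup, hv.eventually_gt_atTop 0] with n hn hn' hvn
    have hpos := (Real.exp_pos _).trans_le hn
    rw [one_div, le_inv_mul_iff₀ hvn, inv_mul_le_iff₀ hvn]
    exact ⟨(Real.le_log_iff_exp_le hpos).2 hn, (Real.log_le_iff_le_exp hpos).2 hn'⟩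
  refine Metric.tendsto_nhds.2 fun η hη => ?_
  filter_upwards [key (η / 2) (half_pos hη)] with n hn
  rw [Real.dist_eq, abs_lt]
  constructor <;> linarith [hn.1, hn.2]

/-- The convex conjugate of `rateLegendre` recovers the epigraph. -/
theorem exists_lt_sub_rateLegendre [∀ n, IsProbabilityMeasure (μ n)]
    (hv : Tendsto v atTop atTop) (hM : ∀ᶠ n in atTop, μ n (Set.Icc (-M) M)ᶜ = 0)
    (H : DominatesCopies μ v q) {x r : ℝ} (h : (x, r) ∉ rateEpigraph μ v) :
    ∃ α : ℝ, r < α * x - rateLegendre μ v α := by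
  have hne := rateEpigraph_nonempty hv hM H
  -- It is enough to find a separating line that is not vertical, normalized to have height
  -- coefficient 1.
  suffices hs : ∃ a u : ℝ, a * x + r < u ∧ ∀ p ∈ rateEpigraph μ v, u ≤ a * p.1 + p.2 by
    obtain ⟨a, u, h1, h2⟩ := hs
    refine ⟨-a, ?_⟩
    have : rateLegendre μ v (-a) ≤ -u := by
      refine csSup_le (hne.image _) ?_
      rintro _ ⟨p, hp, rfl⟩
      have := h2 p hp
      linarith
    linarith
  obtain ⟨f, u, h1, h2⟩ := geometric_hahn_banach_point_closed (convex_rateEpigraph hv H)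
    (isClosed_rateEpigraph hv) h
  set a := f (1, 0) with ha
  set b := f (0, 1) with hb
  have hf : ∀ y s : ℝ, f (y, s) = a * y + b * s := by
    intro y s
    have : ((y, s) : ℝ × ℝ) = y • (1, 0) + s • (0, 1) := by simp
    rw [this, map_add, map_smul, map_smul, smul_eq_mul, smul_eq_mul]
    ring
  rw [hf] at h1
  have h2' : ∀ p ∈ rateEpigraph μ v, u < a * p.1 + b * p.2 := fun p hp => by
    rw [← hf]
    exact h2 p hp
  -- The epigraph is unbounded upwards, so a negative height coefficient would violate the
  -- separation.
  have hb0 : 0 ≤ b := by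
    by_contra! hb0
    obtain ⟨⟨y, s⟩, hy⟩ := hne
    set s' := max s ((u - a * y) / b) with hs'
    have h3 := h2' (y, s') (rateEpigraph_mono hv (le_max_left _ _) hy)
    have h4 : (u - a * y) / b ≤ s' := le_max_right _ _
    rw [div_le_iff_of_neg hb0] at h4
    simp only at h3
    linarith
  rcases hb0.eq_or_lt with hb0 | hb0
  -- Vertical separating line: a large multiple t of it is tilted by adding the height. Heights in
  -- the epigraph are nonnegative, so the points there stay on their side, and t makes the gap at x
  -- equal to |r| + 1 > r.
  · rw [← hb0] at h1 h2'
    set t := (|r| + 1) / (u - a * x) with ht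
    have hux : 0 < u - a * x := by linarith
    have ht' : t * (u - a * x) = |r| + 1 := by
      rw [ht]
      field_simp
    have ht0 : 0 < t := by positivity
    refine ⟨t * a, t * u, ?_, fun p hp => ?_⟩
    · have := le_abs_self r
      linarith
    · have h3 := h2' p hp
      have hr : 0 ≤ p.2 := rateEpigraph_nonneg hv fun ε hε δ hδ => (hp ε hε δ hδ).frequently
      have := mul_lt_mul_of_pos_left h3 ht0
      linarith
  · refine ⟨a / b, u / b, ?_, fun p hp => ?_⟩
    · rw [lt_div_iff₀ hb0]
      have : (a / b * x + r) * b = a * x + b * r := by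
        field_simp
      linarith
    · rw [div_le_iff₀ hb0]
      have : (a / b * p.1 + p.2) * b = a * p.1 + b * p.2 := by
        field_simp
      have := h2' p hp
      linarith

/-- The rate function with epigraph `rateEpigraph μ v`. -/
noncomputable def rateFunction (μ : ℕ → Measure ℝ) (v : ℕ → ℝ) (x : ℝ) : ℝ≥0∞ :=
  ⨅ (r : ℝ≥0) (_ : (x, (r : ℝ)) ∈ rateEpigraph μ v), (r : ℝ≥0∞)

/-- The infimum is attained because the epigraph is closed. This transfers closedness, convexity and
duality from the epigraph to the extended-valued function. -/
theorem rateFunction_le_iff [∀ n, IsProbabilityMeasure (μ n)] (hv : Tendsto v atTop atTop)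
    {x : ℝ} {a : ℝ≥0} : rateFunction μ v x ≤ a ↔ (x, (a : ℝ)) ∈ rateEpigraph μ v := by
  constructor
  · intro h
    refine (isClosed_rateEpigraph hv).closure_subset_iff.2 subset_rfl
      (Metric.mem_closure_iff.2 fun ε hε => ?_)
    obtain ⟨w, hw⟩ : ∃ w : ℝ≥0, (w : ℝ) = ε / 2 := ⟨⟨ε / 2, by positivity⟩, rfl⟩
    have h1 : rateFunction μ v x < (a + w : ℝ≥0) := by
      refine h.trans_lt ?_
      rw [ENNReal.coe_lt_coe]
      refine lt_add_of_pos_right _ ?_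
      rw [← NNReal.coe_pos, hw]
      exact half_pos hε
    simp only [rateFunction, iInf_lt_iff] at h1
    obtain ⟨r, hr, hra⟩ := h1
    rw [ENNReal.coe_lt_coe, ← NNReal.coe_lt_coe, NNReal.coe_add, hw] at hra
    refine ⟨(x, max (r : ℝ) a), rateEpigraph_mono hv (le_max_left _ _) hr, ?_⟩
    rw [Prod.dist_eq, dist_self, max_lt_iff, Real.dist_eq, abs_lt]
    have h5 : max (r : ℝ) a ≤ a + ε / 2 := max_le hra.le (by linarith)
    have h6 : (a : ℝ) ≤ max (r : ℝ) a := le_max_right _ _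
    refine ⟨hε, ?_, ?_⟩ <;> linarith
  · intro h
    exact iInf₂_le a h

theorem rateFunction_le_of_mem [∀ n, IsProbabilityMeasure (μ n)] (hv : Tendsto v atTop atTop)
    {x r : ℝ} (h : (x, r) ∈ rateEpigraph μ v) : (rateFunction μ v x : EReal) ≤ (r : EReal) := by
  have h0 : 0 ≤ r := rateEpigraph_nonneg hv fun ε hε δ hδ => (h ε hε δ hδ).frequently
  lift r to ℝ≥0 using h0
  rw [← EReal.coe_nnreal_eq_coe_real]
  exact EReal.coe_ennreal_le_coe_ennreal_iff.2 ((rateFunction_le_iff hv).2 h)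

theorem isCompact_rateFunction_le [∀ n, IsProbabilityMeasure (μ n)]
    (hv : Tendsto v atTop atTop) (hM : ∀ᶠ n in atTop, μ n (Set.Icc (-M) M)ᶜ = 0) (a : ℝ≥0) :
    IsCompact {x | rateFunction μ v x ≤ a} := by
  have h : {x | rateFunction μ v x ≤ a} = (fun x : ℝ => (x, (a : ℝ))) ⁻¹' rateEpigraph μ v := by
    ext x
    exact rateFunction_le_iff hv
  refine (isCompact_Icc (a := -M) (b := M)).of_isClosed_subset ?_ fun x hx => ?_
  · rw [h]
    exact (isClosed_rateEpigraph hv).preimage (by fun_prop)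
  · exact abs_le.1 (abs_le_of_mem_rateEpigraph hM ((rateFunction_le_iff hv).1 hx))

theorem lowerSemicontinuous_rateFunction [∀ n, IsProbabilityMeasure (μ n)]
    (hv : Tendsto v atTop atTop) (hM : ∀ᶠ n in atTop, μ n (Set.Icc (-M) M)ᶜ = 0) :
    LowerSemicontinuous (rateFunction μ v) := by
  rw [lowerSemicontinuous_iff_isClosed_preimage]
  intro y
  induction y with
  | top => simp
  | coe a => exact (isCompact_rateFunction_le hv hM a).isClosed

theorem convexOn_rateFunction [∀ n, IsProbabilityMeasure (μ n)]
    (hv : Tendsto v atTop atTop) (H : DominatesCopies μ v q) :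
    ConvexOn ℝ≥0 Set.univ (rateFunction μ v) := by
  refine ⟨convex_univ, fun x _ y _ a b ha hb hab => ?_⟩
  rcases eq_or_ne a 0 with rfl | ha'
  · rw [zero_add] at hab
    subst hab
    simp
  rcases eq_or_ne b 0 with rfl | hb'
  · rw [add_zero] at hab
    subst hab
    simp
  rcases eq_or_ne (rateFunction μ v x) ⊤ with hx | hx
  · rw [hx, ENNReal.smul_def, smul_eq_mul, ENNReal.mul_top (by simpa using ha'), top_add]
    exact le_top
  rcases eq_or_ne (rateFunction μ v y) ⊤ with hy | hy
  · rw [hy, ENNReal.smul_def b, smul_eq_mul, ENNReal.mul_top (by simpa using hb'), add_top]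
    exact le_top
  lift rateFunction μ v x to ℝ≥0 using hx with r hr
  lift rateFunction μ v y to ℝ≥0 using hy with s hs
  have h1 := (rateFunction_le_iff hv).1 hr.symm.le
  have h2 := (rateFunction_le_iff hv).1 hs.symm.le
  have h3 := convex_rateEpigraph hv H h1 h2 (NNReal.coe_nonneg a) (NNReal.coe_nonneg b)
    (by rw [← NNReal.coe_add, hab, NNReal.coe_one])
  rw [ENNReal.smul_def, ENNReal.smul_def, smul_eq_mul, smul_eq_mul, ← ENNReal.coe_mul,
    ← ENNReal.coe_mul, ← ENNReal.coe_add, rateFunction_le_iff hv]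
  simpa [NNReal.smul_def] using h3

theorem neg_rateFunction_eq_iInf [∀ n, IsProbabilityMeasure (μ n)]
    (hv : Tendsto v atTop atTop) (hM : ∀ᶠ n in atTop, μ n (Set.Icc (-M) M)ᶜ = 0)
    (H : DominatesCopies μ v q) (x : ℝ) :
    -(rateFunction μ v x : EReal) = ⨅ α : ℝ, ((rateLegendre μ v α - α * x : ℝ) : EReal) := by
  refine le_antisymm (le_iInf fun α => ?_) ?_
  · rcases eq_or_ne (rateFunction μ v x) ⊤ with hx | hx
    · rw [hx]
      simp
    lift rateFunction μ v x to ℝ≥0 using hx with r hr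
    have h1 := le_rateLegendre hv hM α ((rateFunction_le_iff hv).1 hr.symm.le)
    have h2 : -(r : ℝ) ≤ rateLegendre μ v α - α * x := by linarith
    rw [EReal.coe_nnreal_eq_coe_real, ← EReal.coe_neg]
    exact EReal.coe_le_coe_iff.2 h2
  · refine EReal.le_of_forall_lt_iff_le.1 fun z hz => ?_
    have hz' : -(z : EReal) < (rateFunction μ v x : EReal) := by
      rw [EReal.neg_lt_comm] at hz
      exact hz
    suffices hs : ∃ α : ℝ, rateLegendre μ v α - α * x ≤ z by
      obtain ⟨α, hα⟩ := hs
      exact (iInf_le _ α).trans (by exact_mod_cast hα)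
    have hnot : (x, -z) ∉ rateEpigraph μ v := by
      intro hmem
      have h2 : (rateFunction μ v x : EReal) ≤ ((-z : ℝ) : EReal) :=
        rateFunction_le_of_mem hv hmem
      rw [EReal.coe_neg] at h2
      exact absurd hz' (not_lt.2 h2)
    obtain ⟨α, hα⟩ := exists_lt_sub_rateLegendre hv hM H hnot
    exact ⟨α, by linarith⟩

theorem largeDeviationPrinciple_rateFunction [∀ n, IsProbabilityMeasure (μ n)]
    (hv : Tendsto v atTop atTop) (hM : ∀ᶠ n in atTop, μ n (Set.Icc (-M) M)ᶜ = 0)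
    (H : DominatesCopies μ v q) : LargeDeviationPrinciple μ v (rateFunction μ v) where
  scale := hv
  lowerSemicontinuous := lowerSemicontinuous_rateFunction hv hM
  isCompact_level := isCompact_rateFunction_le hv hM
  upper C hC := by
    refine EReal.le_of_forall_lt_iff_le.1 fun z hz => ?_
    -- The room between z' and z is the δ spent in `eventually_measure_le`.
    obtain ⟨z', hz1, hz2⟩ := EReal.lt_iff_exists_real_btwn.1 hz
    have hz2' : z' < z := by exact_mod_cast hz2
    have hmem : ∀ x ∈ C, (x, -z') ∉ rateEpigraph μ v := by
      intro x hx hmem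
      have h2 : (rateFunction μ v x : EReal) ≤ ((-z' : ℝ) : EReal) :=
        rateFunction_le_of_mem hv hmem
      have h3 : (⨅ x ∈ C, (rateFunction μ v x : EReal)) ≤ ((-z' : ℝ) : EReal) :=
        (iInf₂_le x hx).trans h2
      rw [EReal.coe_neg, EReal.le_neg] at h3
      exact absurd hz1 (not_lt.2 h3)
    refine limsup_le_of_le (by isBoundedDefault) ?_
    filter_upwards [eventually_measure_le hv hM H hC hmem (sub_pos.2 hz2'),
      hv.eventually_gt_atTop 0] with n hn hvn
    refine one_div_mul_log_le hvn (hn.trans (le_of_eq ?_))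
    congr 3
    ring
  lower O hO := by
    rw [EReal.neg_le]
    refine le_iInf₂ fun x hx => ?_
    rw [EReal.neg_le]
    rcases eq_or_ne (rateFunction μ v x) ⊤ with hx' | hx'
    · rw [hx']
      simp
    lift rateFunction μ v x to ℝ≥0 using hx' with r hr
    have h1 := (rateFunction_le_iff hv).1 hr.symm.le
    obtain ⟨ε, hε, hεO⟩ := Metric.isOpen_iff.1 hO x hx
    refine EReal.ge_of_forall_gt_iff_ge.1 fun z hz => ?_
    have hz' : z < -(r : ℝ) := by
      rw [EReal.coe_nnreal_eq_coe_real, ← EReal.coe_neg] at hz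
      exact EReal.coe_lt_coe_iff.1 hz
    refine le_liminf_of_le (by isBoundedDefault) ?_
    filter_upwards [h1 ε hε (-(r : ℝ) - z) (by linarith), hv.eventually_gt_atTop 0]
      with n hn hvn
    refine le_one_div_mul_log hvn ?_
    refine le_trans (ENNReal.ofReal_le_ofReal (le_trans (le_of_eq ?_) hn)) ?_
    · congr 1
      ring
    · rw [ofReal_measureReal]
      exact measure_mono hεO

end RateEpigraph

/-! ### One-site observables and local algebras -/

section SiteOp

variable {d N : ℕ}

theorem siteOp_mul (x : Lattice d) (a b : Matrix (Fin N) (Fin N) ℂ) :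
    siteOp x (a * b) = siteOp x a * siteOp x b := by
  ext ξ σ
  simp only [mul_apply_eq_comp, siteOp_apply, Function.update_self, Function.update_idem,
    Matrix.mul_apply, Finset.sum_mul, Finset.mul_sum]
  rw [Finset.sum_comm]
  simp only [mul_assoc]

theorem siteOp_one (x : Lattice d) : siteOp x (1 : Matrix (Fin N) (Fin N) ℂ) = 1 := by
  ext ξ σ
  simp [siteOp_apply, Matrix.one_apply]

/-- `siteOp x` as a homomorphism of algebras. -/
noncomputable def siteOpHom (x : Lattice d) : Matrix (Fin N) (Fin N) ℂ →ₐ[ℂ] Op d N :=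
  AlgHom.ofLinearMap
    { toFun := siteOp x
      map_add' := fun a b => by
        ext ξ σ
        simp [siteOp_apply, add_mul, Finset.sum_add_distrib]
      map_smul' := fun c a => by
        ext ξ σ
        simp [siteOp_apply, Finset.mul_sum, mul_assoc] }
    (siteOp_one x) (siteOp_mul x)

theorem commute_siteOp {x y : Lattice d} (h : x ≠ y) (a b : Matrix (Fin N) (Fin N) ℂ) :
    Commute (siteOp x a) (siteOp y b) := by
  ext ξ σ
  simp only [mul_apply_eq_comp, siteOp_apply, Function.update_of_ne h,
    Function.update_of_ne h.symm, Finset.mul_sum]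
  rw [Finset.sum_comm]
  refine Finset.sum_congr rfl fun t _ => Finset.sum_congr rfl fun u _ => ?_
  rw [Function.update_comm h]
  ring

theorem star_siteOp (x : Lattice d) (a : Matrix (Fin N) (Fin N) ℂ) :
    star (siteOp x a) = siteOp x (star a) := by
  have key : ∀ s t : Fin N, star (pullOp {σ : Conf d N | σ x = s}
      (fun σ => Function.update σ x t) (injOn_update x s t)) =
      pullOp {σ : Conf d N | σ x = t} (fun σ => Function.update σ x s) (injOn_update x t s) := by
    intro s t
    rw [ContinuousLinearMap.star_eq_adjoint]
    symm
    rw [ContinuousLinearMap.eq_adjoint_iff]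
    intro ξ η
    rw [lp.inner_eq_tsum, lp.inner_eq_tsum]
    -- Exchanging the values s and t at x is a bijection of all configurations; on those with σ x =
    -- s it agrees with the map defining the matrix unit, so it reindexes the inner product.
    let f : Conf d N → Conf d N := fun σ => Function.update σ x (Equiv.swap s t (σ x))
    have hf : Function.Involutive f := fun σ => by simp [f]
    let e : Conf d N ≃ Conf d N := hf.toPerm
    have he : ∀ σ, e σ = Function.update σ x (Equiv.swap s t (σ x)) := fun σ => rfl
    rw [← e.tsum_eq]
    refine tsum_congr fun σ => ?_
    simp only [pullOp_apply, pullFun, Set.mem_ofPred_eq, he, Function.update_self,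
      Function.update_idem]
    by_cases h : σ x = s
    · subst h
      simp
    · have h' : ¬ Equiv.swap s t (σ x) = t := by
        rw [Equiv.swap_apply_eq_iff, Equiv.swap_apply_right]
        exact h
      simp [h, h']
  simp only [siteOp, star_sum, star_smul, key]
  rw [Finset.sum_comm]
  rfl

end SiteOp

/-- Centralizers are closed star subalgebras, so commutation passes from generators to the closed
algebras, one side at a time. -/
theorem commute_of_mem_topologicalClosure_adjoin {A : Type*} [Ring A] [StarRing A] [Algebra ℂ A]
    [StarModule ℂ A] [TopologicalSpace A] [IsTopologicalRing A] [ContinuousStar A] [T2Space A]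
    {s t : Set A} (h : ∀ x ∈ s, ∀ y ∈ t, Commute x y) (h' : ∀ x ∈ s, ∀ y ∈ t, Commute x (star y))
    {a b : A} (ha : a ∈ (StarAlgebra.adjoin ℂ s).topologicalClosure)
    (hb : b ∈ (StarAlgebra.adjoin ℂ t).topologicalClosure) : Commute a b := by
  have hclosed : ∀ u : Set A, IsClosed (StarSubalgebra.centralizer ℂ u : Set A) := fun u => by
    rw [StarSubalgebra.coe_centralizer]
    exact Set.isClosed_centralizer _
  have h1 : (StarAlgebra.adjoin ℂ s).topologicalClosure ≤ StarSubalgebra.centralizer ℂ t := by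
    refine StarSubalgebra.topologicalClosure_minimal (StarAlgebra.adjoin_le fun x hx => ?_)
      (hclosed t)
    exact (StarSubalgebra.mem_centralizer_iff ℂ).2 fun y hy =>
      ⟨(h x hx y hy).symm.eq, (h' x hx y hy).symm.eq⟩
  have h2 : (StarAlgebra.adjoin ℂ t).topologicalClosure ≤ StarSubalgebra.centralizer ℂ
      ((StarAlgebra.adjoin ℂ s).topologicalClosure : Set A) := by
    refine StarSubalgebra.topologicalClosure_minimal (StarAlgebra.adjoin_le fun y hy => ?_)
      (hclosed _)
    exact (StarSubalgebra.mem_centralizer_iff ℂ).2 fun x hx =>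
      ⟨(((StarSubalgebra.mem_centralizer_iff ℂ).1 (h1 hx)) y hy).1.symm,
        (((StarSubalgebra.mem_centralizer_iff ℂ).1 (h1 (star_mem hx))) y hy).1.symm⟩
  exact (((StarSubalgebra.mem_centralizer_iff ℂ).1 (h2 hb)) a ha).1

/-! ### Commutation and finite dimensionality of local algebras -/

section LocalAlg

variable {d N : ℕ} {𝒜 𝒞 : StarSubalgebra ℂ (Matrix (Fin N) (Fin N) ℂ)}

theorem localAlg_mono {R R' : Set (Lattice d)} (h : R ⊆ R') :
    localAlg d 𝒜 R ≤ localAlg d 𝒜 R' := by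
  refine StarSubalgebra.topologicalClosure_mono (StarAlgebra.adjoin_mono ?_)
  rintro T ⟨x, hx, a, ha, rfl⟩
  exact ⟨x, h hx, a, ha, rfl⟩

theorem commute_of_disjoint {R R' : Set (Lattice d)} (h : Disjoint R R') {A B : Op d N}
    (hA : A ∈ localAlg d 𝒜 R) (hB : B ∈ localAlg d 𝒜 R') : Commute A B := by
  refine commute_of_mem_topologicalClosure_adjoin ?_ ?_ hA hB
  · rintro _ ⟨x, hx, a, -, rfl⟩ _ ⟨y, hy, b, -, rfl⟩
    exact commute_siteOp (h.ne_of_mem hx hy) a b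
  · rintro _ ⟨x, hx, a, -, rfl⟩ _ ⟨y, hy, b, -, rfl⟩
    rw [star_siteOp]
    exact commute_siteOp (h.ne_of_mem hx hy) a _

theorem commute_of_mem_quasiLocal (h : ∀ a ∈ 𝒞, ∀ b ∈ 𝒞, a * b = b * a) {A B : Op d N}
    (hA : A ∈ quasiLocal d 𝒞) (hB : B ∈ quasiLocal d 𝒞) : Commute A B := by
  have key : ∀ x y : Lattice d, ∀ a ∈ 𝒞, ∀ b ∈ 𝒞, Commute (siteOp x a) (siteOp y b) := by
    intro x y a ha b hb
    rcases eq_or_ne x y with rfl | hxy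
    · rw [Commute, SemiconjBy, ← siteOp_mul, ← siteOp_mul, h a ha b hb]
    · exact commute_siteOp hxy a b
  refine commute_of_mem_topologicalClosure_adjoin ?_ ?_ hA hB
  · rintro _ ⟨x, -, a, ha, rfl⟩ _ ⟨y, -, b, hb, rfl⟩
    exact key x y a ha b hb
  · rintro _ ⟨x, -, a, ha, rfl⟩ _ ⟨y, -, b, hb, rfl⟩
    rw [star_siteOp]
    exact key x y a ha _ (star_mem hb)

/-- Sites are added one at a time. The product of two commuting finite-dimensional subalgebras is
again one; the commutation clause is carried along to make the induction run. -/
theorem exists_fg_subalgebra (Λ : Finset (Lattice d)) :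
    ∃ V : Subalgebra ℂ (Op d N), V.toSubmodule.FG ∧ (∀ x ∈ Λ, ∀ a, siteOp x a ∈ V) ∧
      ∀ T ∈ V, ∀ y ∉ Λ, ∀ b, Commute T (siteOp y b) := by
  classical
  induction Λ using Finset.induction_on with
  | empty =>
    refine ⟨⊥, Subalgebra.fg_bot_toSubmodule, by simp, fun T hT y _ b => ?_⟩
    obtain ⟨c, rfl⟩ := Algebra.mem_bot.1 hT
    exact Algebra.commutes c _
  | insert x Λ hx ih =>
    obtain ⟨V, hV, hmem, hcomm⟩ := ih
    set S : Subalgebra ℂ (Op d N) := (siteOpHom x).range with hS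
    have hSfg : S.toSubmodule.FG := by
      have : S.toSubmodule = LinearMap.range (siteOpHom (N := N) x).toLinearMap := rfl
      rw [this, LinearMap.range_eq_map]
      exact (Module.Finite.fg_top (R := ℂ) (M := Matrix (Fin N) (Fin N) ℂ)).map _
    have hSV : V.toSubmodule * S.toSubmodule = S.toSubmodule * V.toSubmodule := by
      refine Submodule.mul_comm_of_commute fun T hT T' hT' => ?_
      obtain ⟨a, rfl⟩ := hT'
      exact hcomm T hT x hx a
    have hmul : S.toSubmodule * V.toSubmodule * (S.toSubmodule * V.toSubmodule)
        = S.toSubmodule * V.toSubmodule := by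
      rw [mul_assoc, ← mul_assoc V.toSubmodule, hSV, mul_assoc, ← mul_assoc,
        S.isIdempotentElem_toSubmodule.eq, V.isIdempotentElem_toSubmodule.eq]
    have hone : (1 : Op d N) ∈ S.toSubmodule * V.toSubmodule := by
      have := Submodule.mul_mem_mul (M := S.toSubmodule) (N := V.toSubmodule)
          (Subalgebra.one_mem S : (1 : Op d N) ∈ S.toSubmodule)
        (Subalgebra.one_mem V : (1 : Op d N) ∈ V.toSubmodule)
      rwa [mul_one] at this
    refine ⟨(S.toSubmodule * V.toSubmodule).toSubalgebra hone fun a b ha hb => by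
      rw [← hmul]
      exact Submodule.mul_mem_mul ha hb, ?_, ?_, ?_⟩
    · exact hSfg.mul hV
    · intro y hy a
      change siteOp y a ∈ S.toSubmodule * V.toSubmodule
      rcases Finset.mem_insert.1 hy with rfl | hy
      · have := Submodule.mul_mem_mul (M := S.toSubmodule) (N := V.toSubmodule)
          (⟨a, rfl⟩ : siteOp y a ∈ S.toSubmodule)
          (Subalgebra.one_mem V : (1 : Op d N) ∈ V.toSubmodule)
        rwa [mul_one] at this
      · have := Submodule.mul_mem_mul (M := S.toSubmodule) (N := V.toSubmodule)
          (Subalgebra.one_mem S : (1 : Op d N) ∈ S.toSubmodule)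
          (hmem y hy a : siteOp y a ∈ V.toSubmodule)
        rwa [one_mul] at this
    · intro T hT y hy b
      rw [Finset.mem_insert, not_or] at hy
      change T ∈ S.toSubmodule * V.toSubmodule at hT
      refine Submodule.mul_induction_on hT ?_ fun _ _ h1 h2 => h1.add_left h2
      rintro _ ⟨a, rfl⟩ T' hT'
      exact (commute_siteOp (Ne.symm hy.1) a b).mul_left (hcomm T' hT' y hy.2 b)

/-- A finite-dimensional subspace is closed, so taking the closure does not leave the
finite-dimensional algebra. -/
theorem isIntegral_of_mem_localAlg {Λ : Finset (Lattice d)} {A : Op d N}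
    (hA : A ∈ localAlg d 𝒜 (Λ : Set (Lattice d))) : IsIntegral ℂ A := by
  obtain ⟨V, hV, hmem, -⟩ := exists_fg_subalgebra (N := N) Λ
  refine IsIntegral.of_mem_of_fg V hV A ?_
  have hfin : FiniteDimensional ℂ V.toSubmodule := Module.Finite.of_fg hV
  have hclosed : IsClosed (V : Set (Op d N)) :=
    Submodule.closed_of_finiteDimensional V.toSubmodule
  refine closure_minimal (s := (StarAlgebra.adjoin ℂ {T : Op d N | ∃ x ∈ (Λ : Set (Lattice d)),
    ∃ a ∈ 𝒜, T = siteOp x a} : Set (Op d N))) ?_ hclosed hA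
  have : (StarAlgebra.adjoin ℂ {T : Op d N | ∃ x ∈ (Λ : Set (Lattice d)),
      ∃ a ∈ 𝒜, T = siteOp x a}).toSubalgebra ≤ V := by
    rw [StarAlgebra.adjoin_toSubalgebra]
    refine Algebra.adjoin_le ?_
    rintro T (⟨x, hx, a, -, rfl⟩ | ⟨x, hx, a, -, h⟩)
    · exact hmem x hx a
    · rw [star_eq_iff_star_eq, star_siteOp] at h
      rw [← h]
      exact hmem x hx _
  exact this

/-- The spectrum lies in the root set of an annihilating polynomial. Finiteness makes every function
continuous on it, so the functional calculus of indicators is meaningful. -/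
theorem finite_spectrum_of_mem_localAlg {Λ : Finset (Lattice d)} {H : quasiLocal d 𝒜}
    (hH : (H : Op d N) ∈ localAlg d 𝒜 (Λ : Set (Lattice d))) : (spectrum ℝ H).Finite := by
  have hint : IsIntegral ℂ H :=
    (isIntegral_algHom_iff (quasiLocal d 𝒜).subtype.toAlgHom Subtype.val_injective).1
      (isIntegral_of_mem_localAlg hH)
  obtain ⟨p, hp, hpH⟩ := hint
  have hfin : (spectrum ℂ H).Finite := by
    refine (p.roots.toFinset.finite_toSet).subset fun z hz => ?_
    have h1 := spectrum.subset_polynomial_aeval H p ⟨z, hz, rfl⟩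
    have hpH' : Polynomial.aeval H p = 0 := hpH
    rw [hpH'] at h1
    have : Nontrivial (quasiLocal d 𝒜) := by
      by_contra hnt
      rw [not_nontrivial_iff_subsingleton] at hnt
      simp [spectrum.of_subsingleton] at hz
    rw [spectrum.zero_eq, Set.mem_singleton_iff] at h1
    simp only [Finset.mem_coe, Multiset.mem_toFinset]
    exact (Polynomial.mem_roots hp.ne_zero).2 h1
  rw [← spectrum.preimage_algebraMap ℂ]
  exact hfin.preimage (Complex.ofReal_injective.injOn)

end LocalAlg

/-! ### Spectral projections of elements with finite spectrum -/

section FiniteSpectrum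

variable {A : Type*} [CStarAlgebra A]

/-- The spectral projection of `H` for the set `D`. -/
noncomputable def specProj (D : Set ℝ) (H : A) : A := cfc (D.indicator fun _ => (1 : ℝ)) H

theorem norm_eq_mul_norm_of_projection {P : A} (hP : IsSelfAdjoint P)
    (hP' : IsIdempotentElem P) : ‖P‖ = ‖P‖ * ‖P‖ := by
  conv_lhs => rw [← hP'.eq]
  conv_lhs => enter [1, 1]; rw [← hP.star_eq]
  exact CStarRing.norm_star_mul_self

theorem isSelfAdjoint_specProj (D : Set ℝ) (H : A) : IsSelfAdjoint (specProj D H) :=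
  cfc_predicate _ _

theorem commute_specProj {D : Set ℝ} {H T : A} (h : Commute H T) : Commute (specProj D H) T :=
  h.cfc_real _

variable {H : A} (hfin : (spectrum ℝ H).Finite)

include hfin

theorem cfc_mul_of_finite (f g : ℝ → ℝ) :
    cfc (fun x => f x * g x) H = cfc f H * cfc g H :=
  cfc_mul f g H (hfin.continuousOn f) (hfin.continuousOn g)

theorem isIdempotentElem_specProj (D : Set ℝ) : IsIdempotentElem (specProj D H) := by
  rw [IsIdempotentElem, specProj, ← cfc_mul_of_finite hfin]
  congr 1
  funext x
  by_cases h : x ∈ D <;> simp [h]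

theorem cfc_eq_sum_specProj (f : ℝ → ℝ) :
    cfc f H = ∑ l ∈ hfin.toFinset, f l • specProj {l} H := by
  classical
  simp only [specProj]
  have h1 : ∀ l ∈ hfin.toFinset, f l • cfc (({l} : Set ℝ).indicator fun _ => (1 : ℝ)) H =
      cfc (fun x => f l * ({l} : Set ℝ).indicator (fun _ => (1 : ℝ)) x) H := fun l _ =>
    (cfc_const_mul _ _ _ (hfin.continuousOn _)).symm
  rw [Finset.sum_congr rfl h1, ← cfc_sum _ _ _ fun l _ => hfin.continuousOn _]
  refine cfc_congr fun x hx => ?_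
  rw [Finset.sum_apply, Finset.sum_eq_single x]
  · simp
  · intro l _ hl
    simp [hl.symm]
  · intro h
    exact absurd (hfin.mem_toFinset.2 hx) h

omit hfin in
theorem cfc_sub_const (hH : IsSelfAdjoint H) (y : ℝ) :
    cfc (fun x : ℝ => x - y) H = H - algebraMap ℝ A y := by
  rw [cfc_sub (fun x : ℝ => x) (fun _ => y) H, cfc_id' ℝ H, cfc_const y H]

theorem norm_specProj_mul_sub_le (hH : IsSelfAdjoint H) {y ε : ℝ} (hε : 0 ≤ ε) :
    ‖specProj (Metric.ball y ε) H * (H - algebraMap ℝ A y)‖ ≤ ε := by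
  rw [← cfc_sub_const hH, specProj, ← cfc_mul_of_finite hfin]
  refine norm_cfc_le hε fun x _ => ?_
  by_cases h : x ∈ Metric.ball y ε
  · rw [Set.indicator_of_mem h, one_mul, ← dist_eq_norm]
    exact (Metric.mem_ball.1 h).le
  · rw [Set.indicator_of_notMem h, zero_mul, norm_zero]
    exact hε

omit hfin in
theorem eq_zero_of_norm_lt_one {E : A} (hE : IsSelfAdjoint E) (hE' : IsIdempotentElem E)
    (h : ‖E‖ < 1) : E = 0 := by
  have h1 := norm_eq_mul_norm_of_projection hE hE'
  have h2 : ‖E‖ = 0 := by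
    by_contra h3
    have h4 : 0 < ‖E‖ := lt_of_le_of_ne (norm_nonneg _) (Ne.symm h3)
    nlinarith
  exact norm_eq_zero.1 h2

/-- This replaces inclusion of events. Off the ball, H - y is invertible with inverse of norm at
most 1/ε, so P times the complementary spectral projection is a projection of norm less than 1,
hence zero. -/
theorem mul_specProj_eq_self (hH : IsSelfAdjoint H) {P : A} (hP : IsSelfAdjoint P)
    (hP' : IsIdempotentElem P) (hPH : Commute H P) {y ε : ℝ} (hε : 0 < ε)
    (h : ‖P * (H - algebraMap ℝ A y)‖ < ε) : P * specProj (Metric.ball y ε) H = P := by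
  set D := (Metric.ball y ε)ᶜ with hD
  have hQ : specProj (Metric.ball y ε) H = 1 - specProj D H := by
    rw [specProj, specProj, ← cfc_one ℝ H, ← cfc_sub _ _ H (hfin.continuousOn _)
      (hfin.continuousOn _)]
    congr 1
    funext x
    by_cases hx : x ∈ Metric.ball y ε <;> simp [hD, hx]
  have hcomm : Commute (specProj D H) P := commute_specProj hPH
  have hzero : P * specProj D H = 0 := by
    refine eq_zero_of_norm_lt_one ?_ ?_ ?_
    · rw [IsSelfAdjoint, star_mul, hP.star_eq, (isSelfAdjoint_specProj D H).star_eq]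
      exact hcomm.eq
    · rw [IsIdempotentElem, mul_assoc, ← mul_assoc (specProj D H), hcomm.eq, mul_assoc,
        (isIdempotentElem_specProj hfin D).eq, ← mul_assoc, hP'.eq]
    · have h1 : specProj D H = (H - algebraMap ℝ A y) *
          cfc (fun x => D.indicator (fun _ => (1 : ℝ)) x * (x - y)⁻¹) H := by
        rw [← cfc_sub_const hH, ← cfc_mul_of_finite hfin, specProj]
        congr 1
        funext x
        by_cases hx : x ∈ D
        · have : x - y ≠ 0 := fun h0 => hx (by
            rw [sub_eq_zero.1 h0]
            exact Metric.mem_ball_self hε)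
          rw [Set.indicator_of_mem hx, one_mul, mul_inv_cancel₀ this]
        · simp [hx]
      have h2 : ‖cfc (fun x => D.indicator (fun _ => (1 : ℝ)) x * (x - y)⁻¹) H‖ ≤ ε⁻¹ := by
        refine norm_cfc_le (by positivity) fun x _ => ?_
        by_cases hx : x ∈ D
        · rw [Set.indicator_of_mem hx, one_mul, norm_inv, ← dist_eq_norm]
          have : ε ≤ dist x y := not_lt.1 hx
          gcongr
        · rw [Set.indicator_of_notMem hx, zero_mul, norm_zero]
          positivity
      rw [h1, ← mul_assoc]
      calc _ ≤ ‖P * (H - algebraMap ℝ A y)‖ * _ := norm_mul_le _ _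
        _ ≤ ‖P * (H - algebraMap ℝ A y)‖ * ε⁻¹ := by gcongr
        _ < ε * ε⁻¹ := by gcongr
        _ = 1 := mul_inv_cancel₀ hε.ne'
  rw [hQ, mul_sub, mul_one, hzero, sub_zero]

end FiniteSpectrum

/-! ### Distribution of an observable in a state -/

section State

variable {d N : ℕ} {𝒜 : StarSubalgebra ℂ (Matrix (Fin N) (Fin N) ℂ)}
  {ω : quasiLocal d 𝒜 →ₗ[ℂ] ℂ}

theorem IsState.nonneg_of_projection (hω : IsState ω) {P : quasiLocal d 𝒜}
    (hP : IsSelfAdjoint P) (hP' : IsIdempotentElem P) : 0 ≤ (ω P).re ∧ (ω P).im = 0 := by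
  have h := hω.2 P
  rwa [hP.star_eq, hP'.eq] at h

theorem IsState.re_le_of_mul_eq (hω : IsState ω) {P Q : quasiLocal d 𝒜}
    (hP : IsSelfAdjoint P) (hP' : IsIdempotentElem P) (hQ : IsSelfAdjoint Q)
    (hQ' : IsIdempotentElem Q) (h : P * Q = P) : (ω P).re ≤ (ω Q).re := by
  have h' : Q * P = P := by
    have := congrArg star h
    rwa [star_mul, hP.star_eq, hQ.star_eq] at this
  -- Q - P is itself a projection, so its expectation is nonnegative.
  have h1 := (hω.nonneg_of_projection (hQ.sub hP) (by
    rw [IsIdempotentElem, mul_sub, sub_mul, sub_mul, hQ'.eq, h, h', hP'.eq, sub_self,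
      sub_zero])).1
  rw [map_sub, Complex.sub_re] at h1
  linarith

/-- The distribution of an observable with finite spectrum in a state. -/
theorem IsState.exists_distribution (hω : IsState ω) {H : quasiLocal d 𝒜}
    (hH : IsSelfAdjoint H) (hfin : (spectrum ℝ H).Finite) :
    ∃ μ : Measure ℝ, IsProbabilityMeasure μ ∧ μ (spectrum ℝ H)ᶜ = 0 ∧
      (∀ f : ℝ → ℝ, ω (cfc f H) = ((∫ x, f x ∂μ : ℝ) : ℂ)) ∧
      ∀ D : Set ℝ, MeasurableSet D → ω (specProj D H) = ((μ.real D : ℝ) : ℂ) := by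
  set w : ℝ → ℝ := fun l => (ω (specProj {l} H)).re with hw
  have hproj := fun l : ℝ => hω.nonneg_of_projection (isSelfAdjoint_specProj {l} H)
    (isIdempotentElem_specProj hfin {l})
  have hw0 : ∀ l, 0 ≤ w l := fun l => (hproj l).1
  have hωw : ∀ l, ω (specProj {l} H) = (w l : ℂ) := fun l =>
    Complex.ext rfl (by simpa using (hproj l).2)
  have hsum : ∀ f : ℝ → ℝ, ω (cfc f H) = ((∑ l ∈ hfin.toFinset, f l * w l : ℝ) : ℂ) := by
    intro f
    rw [cfc_eq_sum_specProj hfin, map_sum]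
    push_cast
    refine Finset.sum_congr rfl fun l _ => ?_
    rw [← algebraMap_smul ℂ (f l), map_smul, hωw]
    rfl
  set μ : Measure ℝ := ∑ l ∈ hfin.toFinset, ENNReal.ofReal (w l) • Measure.dirac l with hμ
  have hint : ∀ f : ℝ → ℝ, ∫ x, f x ∂μ = ∑ l ∈ hfin.toFinset, f l * w l := by
    intro f
    rw [hμ, integral_finsetSum_measure fun l _ =>
      (integrable_dirac (by simp)).smul_measure ENNReal.ofReal_ne_top]
    refine Finset.sum_congr rfl fun l _ => ?_
    rw [integral_smul_measure, integral_dirac, ENNReal.toReal_ofReal (hw0 l), smul_eq_mul,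
      mul_comm]
  have hone : ∑ l ∈ hfin.toFinset, w l = 1 := by
    have h := hsum 1
    rw [cfc_one ℝ H, hω.1] at h
    simp only [Pi.one_apply, one_mul] at h
    exact_mod_cast h.symm
  have hprob : IsProbabilityMeasure μ := ⟨by
    rw [hμ, Measure.finsetSum_apply]
    simp only [Measure.smul_apply, measure_univ, smul_eq_mul, mul_one]
    rw [← ENNReal.ofReal_sum_of_nonneg fun l _ => hw0 l, hone, ENNReal.ofReal_one]⟩
  refine ⟨μ, hprob, ?_, fun f => by rw [hint, hsum], fun D hD => ?_⟩
  · rw [hμ, Measure.finsetSum_apply]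
    refine Finset.sum_eq_zero fun l hl => ?_
    have hl' : l ∈ spectrum ℝ H := hfin.mem_toFinset.1 hl
    rw [Measure.smul_apply, Measure.dirac_apply' _ hfin.measurableSet.compl]
    simp [hl']
  · rw [specProj, hsum, ← hint]
    rw [integral_indicator_const _ hD, smul_eq_mul, mul_one]

end State

/-! ### Translations and energy estimates -/

section Translation

variable {d N : ℕ} {𝒜 : StarSubalgebra ℂ (Matrix (Fin N) (Fin N) ℂ)}

/-- The translation `τ_x` as a homomorphism of `C*`-algebras. -/
noncomputable def translateHom (x : Lattice d) : quasiLocal d 𝒜 →⋆ₐ[ℂ] quasiLocal d 𝒜 where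
  toFun := translate x
  map_one' := Subtype.ext (map_one (translateOp x))
  map_mul' A B := Subtype.ext (map_mul (translateOp x) (A : Op d N) B)
  map_zero' := Subtype.ext (map_zero (translateOp x))
  map_add' A B := Subtype.ext (map_add (translateOp x) (A : Op d N) B)
  commutes' c := Subtype.ext (AlgHomClass.commutes (translateOp x) c)
  map_star' A := Subtype.ext (map_star (translateOp x) (A : Op d N))

theorem translateHom_apply (x : Lattice d) (A : quasiLocal d 𝒜) :
    translateHom x A = translate x A := rfl

theorem norm_translate (x : Lattice d) (A : quasiLocal d 𝒜) : ‖translate x A‖ = ‖A‖ :=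
  StarAlgEquiv.norm_map (translateOp x) (A : Op d N)

theorem continuous_translateHom (x : Lattice d) :
    Continuous (translateHom x : quasiLocal d 𝒜 →⋆ₐ[ℂ] quasiLocal d 𝒜) :=
  (AddMonoidHomClass.isometry_of_norm _ (norm_translate x)).continuous

theorem translate_smul (x : Lattice d) (c : ℝ) (A : quasiLocal d 𝒜) :
    translate x (c • A) = c • translate x A := by
  rw [← algebraMap_smul ℂ c, ← algebraMap_smul ℂ c, ← translateHom_apply, map_smul]
  rfl

theorem isSelfAdjoint_translate (x : Lattice d) {A : quasiLocal d 𝒜} (h : IsSelfAdjoint A) :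
    IsSelfAdjoint (translate x A) :=
  h.map (translateHom x)

theorem translate_specProj (x : Lattice d) (D : Set ℝ) {H : quasiLocal d 𝒜}
    (hH : IsSelfAdjoint H) (hfin : (spectrum ℝ H).Finite) :
    translate x (specProj D H) = specProj D (translate x H) :=
  StarAlgHom.map_cfc (translateHom x) _ H (hfin.continuousOn _) (continuous_translateHom x) hH
    (isSelfAdjoint_translate x hH)

end Translation

/-! ### Energies of regions and extensivity of the total norm -/

namespace Interaction

variable {d N : ℕ} {𝒜 : StarSubalgebra ℂ (Matrix (Fin N) (Fin N) ℂ)} (Ψ : Interaction d 𝒜)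

theorem norm_map_eq (x : Lattice d) (X : Finset (Lattice d)) :
    ‖Ψ.ψ (X.map (addRightEmbedding x))‖ = ‖Ψ.ψ X‖ := by
  rw [← Ψ.translate_eq, norm_translate]

theorem powerset_map_addRight (x : Lattice d) (Λ : Finset (Lattice d)) :
    (Λ.map (addRightEmbedding x)).powerset
      = Λ.powerset.map (Finset.mapEmbedding (addRightEmbedding x)).toEmbedding := by
  ext X
  simp only [Finset.mem_powerset, Finset.subset_map_iff, Finset.mem_map,
    RelEmbedding.coe_toEmbedding, Finset.mapEmbedding_apply]
  exact ⟨fun ⟨u, hu, h⟩ => ⟨u, hu, h.symm⟩, fun ⟨u, hu, h⟩ => ⟨u, hu, h.symm⟩⟩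

theorem translate_K (x : Lattice d) (Λ : Finset (Lattice d)) :
    translate x (Ψ.K Λ) = Ψ.K (Λ.map (addRightEmbedding x)) := by
  rw [K, K, powerset_map_addRight, Finset.sum_map, ← translateHom_apply, map_sum]
  exact Finset.sum_congr rfl fun X _ => Ψ.translate_eq x X

theorem isSelfAdjoint_K (Λ : Finset (Lattice d)) : IsSelfAdjoint (Ψ.K Λ) := by
  rw [IsSelfAdjoint, K, star_sum]
  exact Finset.sum_congr rfl fun X _ => Ψ.isSelfAdjoint X

theorem coe_K (Λ : Finset (Lattice d)) :
    (Ψ.K Λ : Op d N) = ∑ X ∈ Λ.powerset, (Ψ.ψ X : Op d N) :=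
  map_sum (quasiLocal d 𝒜).subtype _ _

theorem K_mem_localAlg (Λ : Finset (Lattice d)) :
    (Ψ.K Λ : Op d N) ∈ localAlg d 𝒜 (Λ : Set (Lattice d)) := by
  rw [coe_K]
  refine sum_mem fun X hX => localAlg_mono ?_ (Ψ.mem_localAlg X)
  exact_mod_cast Finset.mem_powerset.1 hX

theorem IsClassical.commute_K {Ψ : Interaction d 𝒜} (h : Ψ.IsClassical)
    (Λ Λ' : Finset (Lattice d)) : Commute (Ψ.K Λ) (Ψ.K Λ') := by
  obtain ⟨𝒞, -, hcomm, hmem⟩ := h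
  have hK : ∀ Λ, (Ψ.K Λ : Op d N) ∈ quasiLocal d 𝒞 := fun Λ => by
    rw [coe_K]
    exact sum_mem fun X _ => hmem X
  exact Subtype.ext (commute_of_mem_quasiLocal hcomm (hK Λ) (hK Λ')).eq

/-- The sum of the norms of the nonempty terms of the interaction inside `Λ`. -/
noncomputable def totalNorm (Λ : Finset (Lattice d)) : ℝ :=
  ∑ X ∈ Λ.powerset.erase ∅, ‖Ψ.ψ X‖

theorem totalNorm_map (x : Lattice d) (Λ : Finset (Lattice d)) :
    Ψ.totalNorm (Λ.map (addRightEmbedding x)) = Ψ.totalNorm Λ := by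
  have h : ∅ = (Finset.mapEmbedding (addRightEmbedding x)).toEmbedding
      (∅ : Finset (Lattice d)) := by simp
  rw [totalNorm, totalNorm, powerset_map_addRight]
  conv_lhs => rw [h, ← Finset.map_erase, Finset.sum_map]
  exact Finset.sum_congr rfl fun X _ => Ψ.norm_map_eq x X

theorem K_eq_add (Λ : Finset (Lattice d)) :
    Ψ.K Λ = Ψ.ψ ∅ + ∑ X ∈ Λ.powerset.erase ∅, Ψ.ψ X :=
  (Finset.add_sum_erase _ _ (Finset.empty_mem_powerset Λ)).symm

theorem norm_K_le (Λ : Finset (Lattice d)) : ‖Ψ.K Λ‖ ≤ ‖Ψ.ψ ∅‖ + Ψ.totalNorm Λ := by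
  rw [K_eq_add]
  exact (norm_add_le _ _).trans (add_le_add le_rfl (norm_sum_le _ _))

/-- The energy of `Λ` is the sum of the energies of disjoint subregions up to the total norm of
the terms that are in none of them. -/
theorem norm_K_sub_sum_le {ι : Type*} (J : Finset ι) (C : ι → Finset (Lattice d))
    (Λ : Finset (Lattice d)) (hC : ∀ a ∈ J, C a ⊆ Λ)
    (hdisj : ∀ a ∈ J, ∀ b ∈ J, a ≠ b → Disjoint (C a) (C b)) :
    ‖Ψ.K Λ - ∑ a ∈ J, Ψ.K (C a)‖ ≤
      (J.card + 1) * ‖Ψ.ψ ∅‖ + (Ψ.totalNorm Λ - ∑ a ∈ J, Ψ.totalNorm (C a)) := by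
  classical
  set G := J.biUnion fun a => (C a).powerset.erase ∅ with hG
  have hdisj' : (J : Set ι).PairwiseDisjoint fun a => (C a).powerset.erase ∅ := by
    intro a ha b hb hab
    rw [Function.onFun, Finset.disjoint_left]
    intro X hX hX'
    rw [Finset.mem_erase, Finset.mem_powerset] at hX hX'
    obtain ⟨z, hz⟩ := Finset.nonempty_iff_ne_empty.2 hX.1
    exact Finset.disjoint_left.1 (hdisj a ha b hb hab) (hX.2 hz) (hX'.2 hz)
  have hsub : G ⊆ Λ.powerset.erase ∅ := by
    intro X hX
    obtain ⟨a, ha, hX⟩ := Finset.mem_biUnion.1 hX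
    rw [Finset.mem_erase, Finset.mem_powerset] at hX ⊢
    exact ⟨hX.1, hX.2.trans (hC a ha)⟩
  -- The empty set lies in every power set, so its term is counted once on the left and once per
  -- subregion; nonempty sets lie in at most one subregion.
  have e1 : Ψ.K Λ - ∑ a ∈ J, Ψ.K (C a) = (1 - (J.card : ℝ)) • Ψ.ψ ∅ +
      ∑ X ∈ Λ.powerset.erase ∅ \ G, Ψ.ψ X := by
    simp only [K_eq_add, Finset.sum_add_distrib, Finset.sum_const]
    rw [← Finset.sum_biUnion hdisj', ← Finset.sum_sdiff hsub, sub_smul, one_smul,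
      Nat.cast_smul_eq_nsmul]
    abel
  have e2 : Ψ.totalNorm Λ - ∑ a ∈ J, Ψ.totalNorm (C a) =
      ∑ X ∈ Λ.powerset.erase ∅ \ G, ‖Ψ.ψ X‖ := by
    simp only [totalNorm]
    rw [← Finset.sum_biUnion hdisj', ← Finset.sum_sdiff hsub, add_sub_cancel_right]
  rw [e1, e2]
  refine (norm_add_le _ _).trans (add_le_add ?_ (norm_sum_le _ _))
  rw [norm_smul]
  gcongr
  rw [Real.norm_eq_abs, abs_le]
  constructor <;> linarith [(Nat.cast_nonneg J.card : (0 : ℝ) ≤ J.card)]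

open Classical in
/-- The weight `‖ψ_X‖ / |X|` if `X` contains the origin, and `0` otherwise. -/
noncomputable def originWeight (X : Finset (Lattice d)) : ℝ :=
  if (0 : Lattice d) ∈ X then (X.card : ℝ)⁻¹ * ‖Ψ.ψ X‖ else 0

theorem originWeight_nonneg (X : Finset (Lattice d)) : 0 ≤ Ψ.originWeight X := by
  unfold originWeight
  split_ifs <;> positivity

variable {Ψ} in
theorem FiniteNorm.summable (h : Ψ.FiniteNorm) : Summable Ψ.originWeight := by
  have e : Ψ.originWeight = {X : Finset (Lattice d) | (0 : Lattice d) ∈ X}.indicator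
      fun X => (X.card : ℝ)⁻¹ * ‖Ψ.ψ X‖ := by
    funext X
    by_cases hX : (0 : Lattice d) ∈ X <;> simp [originWeight, hX]
  rw [e, ← summable_subtype_iff_indicator]
  exact h

theorem originWeight_map (x : Lattice d) {X : Finset (Lattice d)} (hx : x ∈ X) :
    Ψ.originWeight (X.map (addRightEmbedding (-x))) = (X.card : ℝ)⁻¹ * ‖Ψ.ψ X‖ := by
  have h : (0 : Lattice d) ∈ X.map (addRightEmbedding (-x)) :=
    Finset.mem_map.2 ⟨x, hx, by simp⟩
  rw [originWeight, if_pos h, Finset.card_map, norm_map_eq]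

open Classical in
-- Double counting: a nonempty X is met at each of its |X| sites with weight ‖ψ_X‖ / |X|.
theorem totalNorm_eq_sum (Λ : Finset (Lattice d)) :
    Ψ.totalNorm Λ = ∑ x ∈ Λ, ∑ X ∈ Λ.powerset with x ∈ X,
      Ψ.originWeight (X.map (addRightEmbedding (-x))) := by
  have h1 : ∀ x ∈ Λ, ∑ X ∈ Λ.powerset with x ∈ X,
      Ψ.originWeight (X.map (addRightEmbedding (-x))) =
      ∑ X ∈ Λ.powerset with x ∈ X, (X.card : ℝ)⁻¹ * ‖Ψ.ψ X‖ := fun x _ =>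
    Finset.sum_congr rfl fun X hX => Ψ.originWeight_map x (Finset.mem_filter.1 hX).2
  rw [Finset.sum_congr rfl h1, Finset.sum_comm' (t' := Λ.powerset) (s' := fun X => X)]
  · rw [← Finset.add_sum_erase _ _ (Finset.empty_mem_powerset Λ), Finset.sum_empty, zero_add]
    refine Finset.sum_congr rfl fun X hX => ?_
    have : (X.card : ℝ) ≠ 0 := by
      have := Finset.card_ne_zero.2 (Finset.nonempty_iff_ne_empty.2 (Finset.mem_erase.1 hX).1)
      exact_mod_cast this
    rw [Finset.sum_const, nsmul_eq_mul, ← mul_assoc, mul_inv_cancel₀ this, one_mul]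
  · intro x X
    simp only [Finset.mem_filter, Finset.mem_powerset]
    exact ⟨fun ⟨_, h2, h3⟩ => ⟨h3, h2⟩, fun ⟨h3, h2⟩ => ⟨h2 h3, h2, h3⟩⟩

variable {Ψ} in
-- Translation is injective on the sets through a given site, so each site contributes a partial sum
-- of the series for ‖Ψ‖.
theorem FiniteNorm.totalNorm_le (h : Ψ.FiniteNorm) (Λ : Finset (Lattice d)) :
    Ψ.totalNorm Λ ≤ Λ.card * ∑' X, Ψ.originWeight X := by
  classical
  rw [totalNorm_eq_sum, ← nsmul_eq_mul]
  refine Finset.sum_le_card_nsmul _ _ _ fun x _ => ?_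
  refine le_trans (le_of_eq ?_) (h.summable.sum_le_tsum
    ((Λ.powerset.filter (x ∈ ·)).map
      (Finset.mapEmbedding (addRightEmbedding (-x))).toEmbedding)
    fun X _ => Ψ.originWeight_nonneg X)
  rw [Finset.sum_map]
  rfl

theorem card_box (d n : ℕ) : (box d n).card = n ^ d := by
  simp [box, Fintype.card_piFinset]

theorem mem_box {n : ℕ} {x : Lattice d} : x ∈ box d n ↔ ∀ i, 0 ≤ x i ∧ x i < n := by
  simp [box]

/-- Up to boundary terms, the total norm of the terms in a large box is extensive. -/
theorem exists_mul_sum_le_totalNorm (F : Finset (Finset (Lattice d))) :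
    ∃ L : ℕ, ∀ m : ℕ, ((m - 2 * L : ℕ) : ℝ) ^ d * ∑ X ∈ F, Ψ.originWeight X
      ≤ Ψ.totalNorm (box d m) := by
  classical
  obtain ⟨L, hL⟩ : ∃ L : ℕ, ∀ X ∈ F, ∀ z ∈ X, ∀ i, |z i| ≤ L := by
    refine ⟨F.sup fun X => X.sup fun z => Finset.univ.sup fun i => (z i).natAbs,
      fun X hX z hz i => ?_⟩
    have h1 : (z i).natAbs ≤ Finset.univ.sup fun i => (z i).natAbs :=
      Finset.le_sup (f := fun i => (z i).natAbs) (Finset.mem_univ i)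
    have h2 := Finset.le_sup (f := fun z : Lattice d => Finset.univ.sup fun i => (z i).natAbs) hz
    have h3 := Finset.le_sup (f := fun X : Finset (Lattice d) =>
      X.sup fun z => Finset.univ.sup fun i => (z i).natAbs) hX
    rw [Int.abs_eq_natAbs]
    exact_mod_cast h1.trans (h2.trans h3)
  refine ⟨L, fun m => ?_⟩
  -- Sites so far from the boundary that every member of F, translated to such a site, stays in the
  -- box.
  set inner : Finset (Lattice d) :=
    Fintype.piFinset fun _ => Finset.Ico (L : ℤ) (m - L) with hinner
  have hcard : inner.card = (m - 2 * L) ^ d := by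
    rw [hinner, Fintype.card_piFinset, Finset.prod_const, Int.card_Ico, Finset.card_univ,
      Fintype.card_fin]
    congr 1
    omega
  have hmem : ∀ x ∈ inner, ∀ i, (L : ℤ) ≤ x i ∧ x i < m - L := fun x hx i => by
    simpa using Fintype.mem_piFinset.1 hx i
  have hsub : inner ⊆ box d m := fun x hx => mem_box.2 fun i => by
    have := hmem x hx i
    omega
  have hcast : ((m - 2 * L : ℕ) : ℝ) ^ d = (inner.card : ℝ) := by
    rw [hcard]
    push_cast
    rfl
  rw [hcast, ← nsmul_eq_mul, totalNorm_eq_sum]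
  refine (Finset.card_nsmul_le_sum inner (fun x => ∑ X ∈ (box d m).powerset with x ∈ X,
    Ψ.originWeight (X.map (addRightEmbedding (-x)))) _ fun x hx => ?_).trans
    (Finset.sum_le_sum_of_subset_of_nonneg hsub fun x _ _ =>
      Finset.sum_nonneg fun X _ => Ψ.originWeight_nonneg _)
  have e : ∑ X ∈ F, Ψ.originWeight X = ∑ X ∈ F with (0 : Lattice d) ∈ X, Ψ.originWeight X := by
    rw [Finset.sum_filter]
    refine Finset.sum_congr rfl fun X _ => ?_
    by_cases h : (0 : Lattice d) ∈ X <;> simp [h, originWeight]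
  have e' : ∑ X ∈ (box d m).powerset with x ∈ X,
      Ψ.originWeight (X.map (addRightEmbedding (-x))) =
      ∑ X ∈ ((box d m).powerset.filter (x ∈ ·)).map
        (Finset.mapEmbedding (addRightEmbedding (-x))).toEmbedding, Ψ.originWeight X := by
    rw [Finset.sum_map]
    rfl
  rw [e, e']
  refine Finset.sum_le_sum_of_subset_of_nonneg (fun X hX => ?_)
    fun X _ _ => Ψ.originWeight_nonneg X
  obtain ⟨hXF, hX0⟩ := Finset.mem_filter.1 hX
  refine Finset.mem_map.2 ⟨X.map (addRightEmbedding x), Finset.mem_filter.2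
    ⟨Finset.mem_powerset.2 fun z hz => ?_, Finset.mem_map.2 ⟨0, hX0, by simp⟩⟩, ?_⟩
  · obtain ⟨w, hw, rfl⟩ := Finset.mem_map.1 hz
    refine mem_box.2 fun i => ?_
    have h1 := abs_le.1 (hL X hXF w hw i)
    have h2 := hmem x hx i
    simp only [addRightEmbedding_apply, Pi.add_apply]
    omega
  · simp only [RelEmbedding.coe_toEmbedding, Finset.mapEmbedding_apply, Finset.map_map]
    convert Finset.map_refl
    ext z : 1
    simp

variable {Ψ} in
-- The upper bound holds in every box. For the lower bound a finite family carrying nearly all of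
-- ‖Ψ‖ has bounded diameter and loses only a boundary layer.
theorem FiniteNorm.tendsto_totalNorm_div (h : Ψ.FiniteNorm) :
    Tendsto (fun m : ℕ => Ψ.totalNorm (box d m) / (m : ℝ) ^ d) atTop
      (𝓝 (∑' X, Ψ.originWeight X)) := by
  refine Metric.tendsto_nhds.2 fun ε hε => ?_
  set B := ∑' X, Ψ.originWeight X with hB
  obtain ⟨F, hF⟩ := (h.summable.hasSum.eventually (lt_mem_nhds
    (show B - ε / 2 < B by linarith))).exists
  obtain ⟨L, hL⟩ := Ψ.exists_mul_sum_le_totalNorm F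
  have hlim : Tendsto (fun m : ℕ => (((m - 2 * L : ℕ) : ℝ) / m) ^ d *
      ∑ X ∈ F, Ψ.originWeight X) atTop (𝓝 (1 ^ d * ∑ X ∈ F, Ψ.originWeight X)) := by
    refine Tendsto.mul_const _ (Tendsto.pow ?_ d)
    have h1 : Tendsto (fun m : ℕ => 1 - (2 * L : ℝ) / m) atTop (𝓝 (1 - 0)) :=
      tendsto_const_nhds.sub (tendsto_const_div_atTop_nhds_zero_nat _)
    rw [sub_zero] at h1
    refine h1.congr' ?_
    filter_upwards [eventually_ge_atTop (2 * L), eventually_gt_atTop 0] with m hm hm0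
    have : (m : ℝ) ≠ 0 := by exact_mod_cast hm0.ne'
    rw [Nat.cast_sub hm]
    push_cast
    field_simp
  rw [one_pow, one_mul] at hlim
  filter_upwards [hlim.eventually (lt_mem_nhds hF), eventually_gt_atTop 0] with m hm hm0
  have hmd : (0 : ℝ) < (m : ℝ) ^ d := by positivity
  have h1 : Ψ.totalNorm (box d m) / (m : ℝ) ^ d ≤ B := by
    rw [div_le_iff₀ hmd]
    have := h.totalNorm_le (box d m)
    rw [card_box] at this
    push_cast at this
    linarith
  have h2 : B - ε / 2 < Ψ.totalNorm (box d m) / (m : ℝ) ^ d := by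
    rw [lt_div_iff₀ hmd]
    rw [div_pow, div_mul_eq_mul_div, lt_div_iff₀ hmd] at hm
    exact hm.trans_le (hL m)
  rw [Real.dist_eq, abs_lt]
  constructor <;> linarith

end Interaction

/-! ### Decoupling of spectral projections of separated blocks -/

theorem norm_le_one_of_projection {A : Type*} [CStarAlgebra A] {P : A} (hP : IsSelfAdjoint P)
    (hP' : IsIdempotentElem P) : ‖P‖ ≤ 1 := by
  have h1 := norm_eq_mul_norm_of_projection hP hP'
  by_contra! h
  nlinarith

/-- Three errors are separated: the energy outside the blocks, the spread within each block, and the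
mismatch of the target values. In the application s and t are the block and box volumes. -/
theorem norm_mul_sub_algebraMap_le {A ι : Type*} [CStarAlgebra A] (J : Finset ι) {P H : A}
    {h : ι → A} {x : ι → ℝ} {y ε s t : ℝ} (hP : ‖P‖ ≤ 1) (hs : 0 ≤ s) (ht : 0 ≤ t)
    (hPh : ∀ a ∈ J, ‖P * (h a - algebraMap ℝ A (x a))‖ ≤ ε) :
    t * ‖P * (H - algebraMap ℝ A y)‖ ≤
      ‖t • H - ∑ a ∈ J, s • h a‖ + J.card * s * ε + |s * ∑ a ∈ J, x a - t * y| := by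
  have hdecomp : t • (H - algebraMap ℝ A y) = (t • H - ∑ a ∈ J, s • h a) +
      s • ∑ a ∈ J, (h a - algebraMap ℝ A (x a)) +
      algebraMap ℝ A (s * ∑ a ∈ J, x a - t * y) := by
    rw [smul_sub, Finset.sum_sub_distrib, smul_sub, ← Finset.smul_sum, ← map_sum, map_sub,
      map_mul, map_mul, ← Algebra.smul_def, ← Algebra.smul_def]
    abel
  have e : t * ‖P * (H - algebraMap ℝ A y)‖ = ‖P * (t • (H - algebraMap ℝ A y))‖ := by
    rw [mul_smul_comm, norm_smul, Real.norm_of_nonneg ht]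
  rw [e, hdecomp, mul_add, mul_add]
  refine norm_add₃_le.trans (add_le_add_three ?_ ?_ ?_)
  · calc _ ≤ ‖P‖ * ‖t • H - ∑ a ∈ J, s • h a‖ := norm_mul_le _ _
      _ ≤ 1 * ‖t • H - ∑ a ∈ J, s • h a‖ := by gcongr
      _ = _ := one_mul _
  · rw [mul_smul_comm, norm_smul, Real.norm_of_nonneg hs, Finset.mul_sum]
    calc _ ≤ s * ∑ a ∈ J, ε := by
          gcongr
          exact norm_sum_le_of_le _ hPh
      _ = _ := by
          rw [Finset.sum_const, nsmul_eq_mul]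
          ring
  · rw [Algebra.algebraMap_eq_smul_one, mul_smul_comm, mul_one, norm_smul, Real.norm_eq_abs]
    calc _ ≤ |s * ∑ a ∈ J, x a - t * y| * (1 : ℝ) := by gcongr
      _ = _ := mul_one _

theorem cube_zero_subset {d : ℕ} (a : Lattice d) (m r : ℕ) : cube a m 0 ⊆ cube a m r :=
  fun z hz i => by
    have h := hz i
    push_cast at h
    constructor <;> omega

section Blocks

variable {d N : ℕ} {𝒜 : StarSubalgebra ℂ (Matrix (Fin N) (Fin N) ℂ)}
  {ω : quasiLocal d 𝒜 →ₗ[ℂ] ℂ}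

theorem specProj_mem_localAlg (D : Set ℝ) {R : Set (Lattice d)} {H : quasiLocal d 𝒜}
    (hH : (H : Op d N) ∈ localAlg d 𝒜 R) :
    ((specProj D H : quasiLocal d 𝒜) : Op d N) ∈ localAlg d 𝒜 R := by
  have hclosed : IsClosed
      ((localAlg d 𝒜 R).comap (quasiLocal d 𝒜).subtype : Set (quasiLocal d 𝒜)) :=
    (isClosed_localAlg R).preimage continuous_subtype_val
  exact cfc_mem (𝕜 := ℝ) (𝕜' := ℂ) (s := (localAlg d 𝒜 R).comap (quasiLocal d 𝒜).subtype)
    (D.indicator fun _ => (1 : ℝ)) hH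

theorem isPositive_of_projection {P : quasiLocal d 𝒜} (hP : IsSelfAdjoint P)
    (hP' : IsIdempotentElem P) : (P : Op d N).IsPositive := by
  have h : (P : Op d N) = star (P : Op d N) * (P : Op d N) := by
    have := congrArg Subtype.val (show P = star P * P by rw [hP.star_eq, hP'.eq])
    exact this
  rw [h, ContinuousLinearMap.star_eq_adjoint]
  exact ContinuousLinearMap.isPositive_adjoint_comp_self _

/-- P is the product of the block projections, which commute because their supports are disjoint;
each new block costs one factor exp(-c). The commutation clause later makes P commute with the
energy of the large box. -/
theorem exists_block_projection (hω : IsState ω) (hinv : IsTranslationInvariant ω)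
    {m g : ℕ} {c : ℝ}
    (hdec : ∀ (a : Lattice d) (A B : quasiLocal d 𝒜),
      (A : Op d N) ∈ localAlg d 𝒜 (cube a m 0) → (A : Op d N).IsPositive →
      (B : Op d N) ∈ localAlg d 𝒜 (cube a m g)ᶜ → (B : Op d N).IsPositive →
      Real.exp (-c) * (ω A).re * (ω B).re ≤ (ω (A * B)).re)
    {H : quasiLocal d 𝒜} (hH : IsSelfAdjoint H) (hfin : ∀ a, (spectrum ℝ (translate a H)).Finite)
    (hfin0 : (spectrum ℝ H).Finite)
    (hmem : ∀ a, (translate a H : Op d N) ∈ localAlg d 𝒜 (cube a m 0))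
    (x : Lattice d → ℝ) {ε : ℝ} (hε : 0 < ε) (J : Finset (Lattice d))
    (hJ : ∀ a ∈ J, ∀ b ∈ J, a ≠ b → Disjoint (cube a m g) (cube b m 0)) :
    ∃ P : quasiLocal d 𝒜, IsSelfAdjoint P ∧ IsIdempotentElem P ∧
      (P : Op d N) ∈ localAlg d 𝒜 (⋃ a ∈ J, cube a m 0) ∧
      (∀ T, (∀ a, Commute (translate a H) T) → Commute P T) ∧
      (∀ a ∈ J, ‖P * (translate a H - algebraMap ℝ (quasiLocal d 𝒜) (x a))‖ ≤ ε) ∧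
      ∏ a ∈ J, (Real.exp (-c) * (ω (specProj (Metric.ball (x a) ε) H)).re) ≤ (ω P).re := by
  classical
  induction J using Finset.induction_on with
  | empty =>
    refine ⟨1, IsSelfAdjoint.one _, IsIdempotentElem.one, one_mem _,
      fun T _ => Commute.one_left T, by simp, ?_⟩
    rw [hω.1]
    simp
  | insert a J ha ih =>
    obtain ⟨P, hP, hP', hPmem, hPcomm, hPnorm, hPω⟩ := ih fun b hb b' hb' =>
      hJ b (Finset.mem_insert_of_mem hb) b' (Finset.mem_insert_of_mem hb')
    set Ha := translate a H with hHa
    have hHa' : IsSelfAdjoint Ha := isSelfAdjoint_translate a hH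
    set E := specProj (Metric.ball (x a) ε) Ha with hE
    have hEs : IsSelfAdjoint E := isSelfAdjoint_specProj _ _
    have hEi : IsIdempotentElem E := isIdempotentElem_specProj (hfin a) _
    have hEmem : (E : Op d N) ∈ localAlg d 𝒜 (cube a m 0) :=
      specProj_mem_localAlg (H := Ha) (Metric.ball (x a) ε) (hmem a)
    have hcubes : (⋃ b ∈ J, cube b m 0) ⊆ (cube a m g)ᶜ := by
      intro z hz hz'
      obtain ⟨b, hb, hzb⟩ := Set.mem_iUnion₂.1 hz
      refine Set.disjoint_left.1 (hJ a (Finset.mem_insert_self _ _) b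
        (Finset.mem_insert_of_mem hb) ?_) hz' hzb
      rintro rfl
      exact ha hb
    have hEP : Commute E P := by
      refine Subtype.ext (commute_of_disjoint ?_ hEmem hPmem).eq
      exact Set.disjoint_left.2 fun z hz hz' => hcubes hz' (cube_zero_subset a m g hz)
    -- Translation invariance brings the probability of the block back to the origin.
    have hωE : (ω E).re = (ω (specProj (Metric.ball (x a) ε) H)).re := by
      rw [hE, hHa, ← translate_specProj a _ hH hfin0, hinv]
    refine ⟨E * P, ?_, ?_, ?_, fun T hT => ?_, fun b hb => ?_, ?_⟩
    · rw [IsSelfAdjoint, star_mul, hP.star_eq, hEs.star_eq, hEP.eq]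
    · rw [IsIdempotentElem, mul_assoc, ← mul_assoc P, ← hEP.eq, mul_assoc E P P, hP'.eq,
        ← mul_assoc, hEi.eq]
    · refine (localAlg d 𝒜 (⋃ b ∈ insert a J, cube b m 0)).mul_mem
        (localAlg_mono ?_ hEmem) (localAlg_mono ?_ hPmem)
      · exact Set.subset_biUnion_of_mem (u := fun b => cube b m 0) (Finset.mem_insert_self a J)
      · exact Set.biUnion_subset_biUnion_left fun b hb => Finset.mem_insert_of_mem hb
    · exact (commute_specProj (hT a)).mul_left (hPcomm T hT)
    · rcases Finset.mem_insert.1 hb with rfl | hb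
      · rw [hEP.eq, mul_assoc]
        calc _ ≤ ‖P‖ * _ := norm_mul_le _ _
          _ ≤ 1 * ε := mul_le_mul (norm_le_one_of_projection hP hP')
              (norm_specProj_mul_sub_le (hfin b) hHa' hε.le) (norm_nonneg _) zero_le_one
          _ = ε := one_mul ε
      · rw [mul_assoc]
        calc _ ≤ ‖E‖ * _ := norm_mul_le _ _
          _ ≤ 1 * ε := mul_le_mul (norm_le_one_of_projection hEs hEi)
              (hPnorm b hb) (norm_nonneg _) zero_le_one
          _ = ε := one_mul ε
    · rw [Finset.prod_insert ha]
      refine le_trans ?_ (hdec a E P hEmem (isPositive_of_projection hEs hEi)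
        (localAlg_mono hcubes hPmem) (isPositive_of_projection hP hP'))
      rw [hωE]
      refine mul_le_mul_of_nonneg_left hPω ?_
      rw [← hωE]
      exact mul_nonneg (Real.exp_pos _).le (hω.nonneg_of_projection hEs hEi).1

theorem coe_map_box (a : Lattice d) (m : ℕ) :
    ((box d m).map (addRightEmbedding a) : Set (Lattice d)) = cube a m 0 := by
  ext z
  simp only [Finset.coe_map, Set.mem_image, Finset.mem_coe, Interaction.mem_box,
    addRightEmbedding_apply]
  constructor
  · rintro ⟨w, hw, rfl⟩ i
    have := hw i
    simp only [Pi.add_apply]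
    push_cast
    constructor <;> omega
  · intro hz
    refine ⟨z - a, fun i => ?_, by simp⟩
    have := hz i
    push_cast at this
    simp only [Pi.sub_apply]
    constructor <;> omega

/-- The energy density in the cube of side `n`. -/
noncomputable def energyDensity (Ψ : Interaction d 𝒜) (n : ℕ) : quasiLocal d 𝒜 :=
  ((box d n).card : ℝ)⁻¹ • Ψ.K (box d n)

theorem isSelfAdjoint_energyDensity (Ψ : Interaction d 𝒜) (n : ℕ) :
    IsSelfAdjoint (energyDensity Ψ n) :=
  (IsSelfAdjoint.all ((box d n).card : ℝ)⁻¹).smul (Ψ.isSelfAdjoint_K _)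

theorem translate_energyDensity (Ψ : Interaction d 𝒜) (n : ℕ) (a : Lattice d) :
    translate a (energyDensity Ψ n)
      = ((box d n).card : ℝ)⁻¹ • Ψ.K ((box d n).map (addRightEmbedding a)) := by
  rw [energyDensity, translate_smul, Interaction.translate_K]

theorem smul_K_mem_localAlg (Ψ : Interaction d 𝒜) (r : ℝ) (Λ : Finset (Lattice d)) :
    ((r • Ψ.K Λ : quasiLocal d 𝒜) : Op d N) ∈ localAlg d 𝒜 (Λ : Set (Lattice d)) := by
  have : ((r • Ψ.K Λ : quasiLocal d 𝒜) : Op d N) = (r : ℂ) • (Ψ.K Λ : Op d N) := by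
    rw [← algebraMap_smul ℂ r]
    rfl
  rw [this]
  exact SMulMemClass.smul_mem _ (Ψ.K_mem_localAlg Λ)

theorem finite_spectrum_energyDensity (Ψ : Interaction d 𝒜) (n : ℕ) :
    (spectrum ℝ (energyDensity Ψ n)).Finite :=
  finite_spectrum_of_mem_localAlg (smul_K_mem_localAlg Ψ _ _)

/-- The energy density of a large cube is close to a prescribed value with at least the
probability that the energy densities of separated blocks are close to prescribed values. -/
theorem prod_le_of_blocks (hω : IsState ω) (hinv : IsTranslationInvariant ω)
    {Ψ : Interaction d 𝒜} (hcl : Ψ.IsClassical) {m n g : ℕ} (hm : 0 < m) (hn : 0 < n) {c : ℝ}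
    (hdec : ∀ (a : Lattice d) (A B : quasiLocal d 𝒜),
      (A : Op d N) ∈ localAlg d 𝒜 (cube a m 0) → (A : Op d N).IsPositive →
      (B : Op d N) ∈ localAlg d 𝒜 (cube a m g)ᶜ → (B : Op d N).IsPositive →
      Real.exp (-c) * (ω A).re * (ω B).re ≤ (ω (A * B)).re)
    (x : Lattice d → ℝ) {ε : ℝ} (hε : 0 < ε) (J : Finset (Lattice d))
    (hJ : ∀ a ∈ J, ∀ b ∈ J, a ≠ b → Disjoint (cube a m g) (cube b m 0)) {y ε' : ℝ}
    (h : ‖Ψ.K (box d n) - ∑ a ∈ J, Ψ.K ((box d m).map (addRightEmbedding a))‖ +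
      J.card * (m : ℝ) ^ d * ε + |(m : ℝ) ^ d * ∑ a ∈ J, x a - (n : ℝ) ^ d * y|
        < (n : ℝ) ^ d * ε') :
    ∏ a ∈ J, (Real.exp (-c) * (ω (specProj (Metric.ball (x a) ε) (energyDensity Ψ m))).re)
      ≤ (ω (specProj (Metric.ball y ε') (energyDensity Ψ n))).re := by
  have hmd : (0 : ℝ) < (m : ℝ) ^ d := by positivity
  have hnd : (0 : ℝ) < (n : ℝ) ^ d := by positivity
  have hcard : ∀ k : ℕ, ((box d k).card : ℝ) = (k : ℝ) ^ d := fun k => by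
    rw [Interaction.card_box, Nat.cast_pow]
  have hmem : ∀ a, (translate a (energyDensity Ψ m) : Op d N) ∈ localAlg d 𝒜 (cube a m 0) := by
    intro a
    rw [translate_energyDensity, ← coe_map_box]
    exact smul_K_mem_localAlg Ψ _ _
  have hfin : ∀ a, (spectrum ℝ (translate a (energyDensity Ψ m))).Finite := by
    intro a
    refine finite_spectrum_of_mem_localAlg (Λ := (box d m).map (addRightEmbedding a)) ?_
    rw [coe_map_box]
    exact hmem a
  obtain ⟨P, hP, hP', -, hPcomm, hPnorm, hPω⟩ := exists_block_projection hω hinv hdec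
    (isSelfAdjoint_energyDensity Ψ m) hfin (finite_spectrum_energyDensity Ψ m) hmem x hε J hJ
  refine hPω.trans ?_
  have hε' : 0 < ε' := by
    by_contra! hneg
    have : (n : ℝ) ^ d * ε' ≤ 0 := mul_nonpos_of_nonneg_of_nonpos hnd.le hneg
    have h2 : 0 ≤ J.card * (m : ℝ) ^ d * ε := by positivity
    linarith [norm_nonneg (Ψ.K (box d n) - ∑ a ∈ J, Ψ.K ((box d m).map (addRightEmbedding a))),
      abs_nonneg ((m : ℝ) ^ d * ∑ a ∈ J, x a - (n : ℝ) ^ d * y)]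
  -- Classicality enters here: the energies of overlapping regions commute.
  have hcomm : Commute P (energyDensity Ψ n) := by
    refine hPcomm _ fun a => ?_
    rw [translate_energyDensity, energyDensity]
    have h1 := hcl.commute_K ((box d m).map (addRightEmbedding a)) (box d n)
    have h2 := h1.smul_left ((box d m).card : ℝ)⁻¹
    exact h2.smul_right ((box d n).card : ℝ)⁻¹
  refine hω.re_le_of_mul_eq hP hP' (isSelfAdjoint_specProj _ _)
    (isIdempotentElem_specProj (finite_spectrum_energyDensity Ψ n) _) ?_
  refine mul_specProj_eq_self (finite_spectrum_energyDensity Ψ n)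
    (isSelfAdjoint_energyDensity Ψ n) hP hP' hcomm.symm hε' ?_
  have hK : ∀ (k : ℕ) (Λ : Finset (Lattice d)), 0 < (k : ℝ) ^ d →
      (k : ℝ) ^ d • (((box d k).card : ℝ)⁻¹ • Ψ.K Λ) = Ψ.K Λ := fun k Λ hk => by
    rw [hcard, smul_inv_smul₀ hk.ne']
  have hbound := norm_mul_sub_algebraMap_le J (norm_le_one_of_projection hP hP') hmd.le hnd.le
    (H := energyDensity Ψ n) (y := y) hPnorm
  have e1 : (n : ℝ) ^ d • energyDensity Ψ n = Ψ.K (box d n) := hK n _ hnd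
  have e2 : ∀ a, (m : ℝ) ^ d • translate a (energyDensity Ψ m)
      = Ψ.K ((box d m).map (addRightEmbedding a)) := fun a => by
    rw [translate_energyDensity]
    exact hK m _ hmd
  rw [e1, Finset.sum_congr rfl fun a _ => e2 a] at hbound
  exact lt_of_mul_lt_mul_left (hbound.trans_lt h) hnd.le

/-- The corners of the blocks of side `m` with spacing `p`. -/
noncomputable def blockCorners (d p k : ℕ) : Finset (Lattice d) :=
  open Classical in (box d k).image fun j => (p : ℤ) • j

theorem card_blockCorners {p : ℕ} (hp : 0 < p) (k : ℕ) : (blockCorners d p k).card = k ^ d := by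
  classical
  rw [blockCorners, Finset.card_image_of_injective, Interaction.card_box]
  exact smul_right_injective _ (by exact_mod_cast hp.ne')

/-- Corners differ by at least m + g in some coordinate, so a gap of width g between neighbouring
blocks is enough: only one of the two cubes is enlarged. -/
theorem disjoint_cube_blockCorners {m g k : ℕ} {a b : Lattice d}
    (ha : a ∈ blockCorners d (m + g) k) (hb : b ∈ blockCorners d (m + g) k) (hab : a ≠ b) :
    Disjoint (cube a m g) (cube b m 0) := by
  classical
  obtain ⟨i, -, rfl⟩ := Finset.mem_image.1 ha
  obtain ⟨j, -, rfl⟩ := Finset.mem_image.1 hb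
  have hij : i ≠ j := fun h => hab (by rw [h])
  obtain ⟨l, hl⟩ := Function.ne_iff.1 hij
  rw [Set.disjoint_left]
  intro z hz hz'
  have h1 := hz l
  have h2 := hz' l
  simp only [Pi.smul_apply, smul_eq_mul, Nat.cast_add, Nat.cast_zero] at h1 h2
  have hp : (0 : ℤ) ≤ (m : ℤ) + g := by positivity
  rcases lt_or_gt_of_ne hl with h | h
  · have h3 : ((m : ℤ) + g) * (i l + 1) ≤ (m + g) * j l := mul_le_mul_of_nonneg_left h hp
    rw [mul_add, mul_one] at h3
    linarith [h1.1, h1.2, h2.1, h2.2]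
  · have h3 : ((m : ℤ) + g) * (j l + 1) ≤ (m + g) * i l := mul_le_mul_of_nonneg_left h hp
    rw [mul_add, mul_one] at h3
    linarith [h1.1, h1.2, h2.1, h2.2]

theorem map_box_subset_box {m g n k : ℕ} (hk : k * (m + g) ≤ n) {a : Lattice d}
    (ha : a ∈ blockCorners d (m + g) k) :
    (box d m).map (addRightEmbedding a) ⊆ box d n := by
  classical
  obtain ⟨j, hj, rfl⟩ := Finset.mem_image.1 ha
  intro z hz
  obtain ⟨w, hw, rfl⟩ := Finset.mem_map.1 hz
  rw [Interaction.mem_box] at hj hw ⊢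
  intro i
  have h1 := hj i
  have h2 := hw i
  simp only [addRightEmbedding_apply, Pi.add_apply, Pi.smul_apply, smul_eq_mul, Nat.cast_add]
  have hp : (0 : ℤ) ≤ (m : ℤ) + g := by positivity
  have h3 : ((m : ℤ) + g) * (j i + 1) ≤ (m + g) * k := mul_le_mul_of_nonneg_left h1.2 hp
  have h4 : ((m : ℤ) + g) * k ≤ n := by
    rw [mul_comm]
    exact_mod_cast hk
  have h5 : 0 ≤ ((m : ℤ) + g) * j i := mul_nonneg hp h1.1
  rw [mul_add, mul_one] at h3
  have hg : (0 : ℤ) ≤ g := by positivity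
  constructor <;> linarith [h2.1, h2.2]

end Blocks

/-! ### The large deviation principle for the energy density -/

theorem tendsto_natDiv_div {p : ℕ} (hp : 0 < p) :
    Tendsto (fun n : ℕ => ((n / p : ℕ) : ℝ) / n) atTop (𝓝 (1 / p)) := by
  have h := (tendsto_nat_floor_mul_div_atTop (R := ℝ) (a := 1 / p) (by positivity)).comp
    tendsto_natCast_atTop_atTop
  refine h.congr fun n => ?_
  simp only [Function.comp_apply]
  rw [one_div_mul_eq_div, Nat.floor_div_eq_div]

section EnergyDensity

variable {d N : ℕ} {𝒜 : StarSubalgebra ℂ (Matrix (Fin N) (Fin N) ℂ)}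
  {ω : quasiLocal d 𝒜 →ₗ[ℂ] ℂ}

theorem norm_energyDensity_le {Ψ : Interaction d 𝒜} (hΨ : Ψ.FiniteNorm) {n : ℕ} (hn : 0 < n) :
    ‖energyDensity Ψ n‖ ≤ ‖Ψ.ψ ∅‖ + ∑' X, Ψ.originWeight X := by
  have hcard : (1 : ℝ) ≤ (box d n).card := by
    rw [Interaction.card_box]
    exact_mod_cast Nat.one_le_pow _ _ hn
  rw [energyDensity, norm_smul, norm_inv, Real.norm_of_nonneg (by positivity),
    inv_mul_le_iff₀ (by positivity)]
  calc ‖Ψ.K (box d n)‖ ≤ ‖Ψ.ψ ∅‖ + Ψ.totalNorm (box d n) := Ψ.norm_K_le _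
    _ ≤ (box d n).card * ‖Ψ.ψ ∅‖ + (box d n).card * ∑' X, Ψ.originWeight X :=
        add_le_add (le_mul_of_one_le_left (norm_nonneg _) hcard) (hΨ.totalNorm_le _)
    _ = _ := by ring

theorem IsState.spectrum_subset_Icc (hω : IsState ω) {H : quasiLocal d 𝒜} {M : ℝ}
    (hM : ‖H‖ ≤ M) : spectrum ℝ H ⊆ Set.Icc (-M) M := by
  -- A normalized functional excludes the zero algebra, where 1 need not have norm 1.
  have hnt : Nontrivial (quasiLocal d 𝒜) := ⟨1, 0, fun h => by
    have h1 := hω.1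
    rw [h, map_zero] at h1
    exact zero_ne_one h1⟩
  intro x hx
  have h1 : ‖x‖ ≤ ‖H‖ := spectrum.norm_le_norm_of_mem hx
  exact abs_le.1 (h1.trans hM)

theorem exp_smul_K_eq_cfc (Ψ : Interaction d 𝒜) (α : ℝ) {n : ℕ} (hn : 0 < n) :
    NormedSpace.exp (α • Ψ.K (box d n))
      = cfc (fun x : ℝ => Real.exp (α * (box d n).card * x)) (energyDensity Ψ n) := by
  have hH := isSelfAdjoint_energyDensity Ψ n
  have hcard : ((box d n).card : ℝ) ≠ 0 := by
    rw [Interaction.card_box]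
    exact_mod_cast (pow_pos hn d).ne'
  have e : α • Ψ.K (box d n) = (α * (box d n).card) • energyDensity Ψ n := by
    rw [energyDensity, mul_smul, smul_inv_smul₀ hcard]
  have hs : IsSelfAdjoint ((α * ((box d n).card : ℝ)) • energyDensity Ψ n) :=
    (IsSelfAdjoint.all (α * ((box d n).card : ℝ))).smul hH
  rw [e, ← CFC.real_exp_eq_normedSpace_exp hs]
  exact (cfc_comp_const_mul (α * ((box d n).card : ℝ)) Real.exp (energyDensity Ψ n)
    (by fun_prop) hH).symm

/-- The box of side n is tiled by cells of side m + g(m), each holding one block of side m. Since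
g(m)/m → 0, the blocks fill almost the whole volume once m and then n are large. -/
theorem dominatesCopies_of_decoupled (hd : 1 ≤ d) (hω : IsState ω)
    (hinv : IsTranslationInvariant ω) {Ψ : Interaction d 𝒜} (hcl : Ψ.IsClassical)
    (hΨ : Ψ.FiniteNorm) {g : ℕ → ℕ} {c : ℕ → ℝ}
    (hg : Tendsto (fun m => (g m : ℝ) / m) atTop (𝓝 0))
    (hc : Tendsto (fun m : ℕ => c m / (m : ℝ) ^ d) atTop (𝓝 0))
    (hdec : ∀ (m : ℕ) (a : Lattice d) (A B : quasiLocal d 𝒜),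
      (A : Op d N) ∈ localAlg d 𝒜 (cube a m 0) → (A : Op d N).IsPositive →
      (B : Op d N) ∈ localAlg d 𝒜 (cube a m (g m))ᶜ → (B : Op d N).IsPositive →
      Real.exp (-c m) * (ω A).re * (ω B).re ≤ (ω (A * B)).re)
    {μ : ℕ → Measure ℝ}
    (hμ : ∀ (n : ℕ) (x ε : ℝ), (ω (specProj (Metric.ball x ε) (energyDensity Ψ n))).re =
      (μ n).real (Metric.ball x ε)) :
    DominatesCopies μ (fun n => ((box d n).card : ℝ)) fun m n => (n / (m + g m)) ^ d where
  tendsto_copies := by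
    filter_upwards [eventually_gt_atTop 0] with m hm
    exact (tendsto_pow_atTop (by omega)).comp (Nat.tendsto_div_const_atTop (by omega))
  mul_scale_le m n := by
    simp only [Interaction.card_box]
    rw [← Nat.cast_mul, ← mul_pow]
    exact_mod_cast Nat.pow_le_pow_left
      ((Nat.mul_le_mul_left _ (Nat.le_add_right m (g m))).trans (Nat.div_mul_le_self n _)) d
  prod_le x y ε hε η hη := by
    classical
    set B := ∑' X, Ψ.originWeight X with hB
    set κ := ‖Ψ.ψ ∅‖ with hκ
    set Y := |x| + |y| with hY
    have hY0 : 0 ≤ Y := by positivity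
    have hθ : Tendsto (fun m : ℕ => ((m : ℝ) / (m + g m : ℕ)) ^ d) atTop (𝓝 1) := by
      have h1 : Tendsto (fun m : ℕ => (1 / (1 + (g m : ℝ) / m)) ^ d) atTop
          (𝓝 ((1 / (1 + 0)) ^ d)) :=
        ((tendsto_const_nhds.div (tendsto_const_nhds.add hg) (by norm_num)).pow d)
      rw [add_zero, div_one, one_pow] at h1
      refine h1.congr' ?_
      filter_upwards [eventually_gt_atTop 0] with m hm
      have : (m : ℝ) ≠ 0 := by exact_mod_cast hm.ne'
      push_cast
      congr 1
      field_simp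
    have hpow : Tendsto (fun m : ℕ => 2 * κ / (m : ℝ) ^ d) atTop (𝓝 0) :=
      tendsto_const_nhds.div_atTop
        ((tendsto_pow_atTop (by omega)).comp tendsto_natCast_atTop_atTop)
    -- Error per site, to be kept below η: the repeated empty-set term, the interaction terms in no
    -- block, and the uncovered volume times the largest target value.
    have herr : Tendsto (fun m : ℕ => 2 * κ / (m : ℝ) ^ d + (B - ((m : ℝ) / (m + g m : ℕ)) ^ d *
        (Ψ.totalNorm (box d m) / (m : ℝ) ^ d)) + (1 - ((m : ℝ) / (m + g m : ℕ)) ^ d) * Y) atTop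
        (𝓝 (0 + (B - 1 * B) + (1 - 1) * Y)) :=
      (hpow.add (tendsto_const_nhds.sub (hθ.mul hΨ.tendsto_totalNorm_div))).add
        ((tendsto_const_nhds.sub hθ).mul_const Y)
    rw [show 0 + (B - 1 * B) + (1 - 1) * Y = 0 by ring] at herr
    filter_upwards [herr.eventually (gt_mem_nhds hη), hc.eventually (gt_mem_nhds hη),
      eventually_gt_atTop 0] with m hm hcm hm0
    set p := m + g m with hp
    have hp0 : 0 < p := by omega
    have hmd : (0 : ℝ) < (m : ℝ) ^ d := by positivity
    have hθn : Tendsto (fun n : ℕ => (((n / p : ℕ) : ℝ) / n * m) ^ d) atTop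
        (𝓝 (((m : ℝ) / p) ^ d)) := by
      have := ((tendsto_natDiv_div hp0).mul_const (m : ℝ)).pow d
      rwa [one_div_mul_eq_div] at this
    have herrn : Tendsto (fun n : ℕ => 2 * κ / (m : ℝ) ^ d + (B - (((n / p : ℕ) : ℝ) / n * m) ^ d *
        (Ψ.totalNorm (box d m) / (m : ℝ) ^ d)) + (1 - (((n / p : ℕ) : ℝ) / n * m) ^ d) * Y) atTop
        (𝓝 (2 * κ / (m : ℝ) ^ d + (B - ((m : ℝ) / p) ^ d *
        (Ψ.totalNorm (box d m) / (m : ℝ) ^ d)) + (1 - ((m : ℝ) / p) ^ d) * Y)) :=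
      (tendsto_const_nhds.add (tendsto_const_nhds.sub (hθn.mul_const _))).add
        ((tendsto_const_nhds.sub hθn).mul_const Y)
    filter_upwards [herrn.eventually (gt_mem_nhds hm), eventually_ge_atTop p] with n hn hnp k hk
    have hn0 : 0 < n := hp0.trans_le hnp
    have hnd : (0 : ℝ) < (n : ℝ) ^ d := by positivity
    set J := blockCorners d p (n / p) with hJ
    have hJcard : J.card = (n / p) ^ d := card_blockCorners hp0 _
    set q := (n / p) ^ d with hq
    have hq0 : 0 < q := pow_pos (Nat.div_pos hnp hp0) d
    have hqr : (1 : ℝ) ≤ q := by exact_mod_cast hq0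
    have hqm : (q : ℝ) * (m : ℝ) ^ d ≤ (n : ℝ) ^ d := by
      rw [hq, Nat.cast_pow, ← mul_pow]
      exact_mod_cast Nat.pow_le_pow_left
        ((Nat.mul_le_mul_left _ (Nat.le_add_right m (g m))).trans (Nat.div_mul_le_self n _)) d
    -- Any k of the blocks may be assigned the value x.
    obtain ⟨J₁, hJ₁, hJ₁card⟩ := Finset.exists_subset_card_eq (hk.trans hJcard.symm.le)
    set x' : Lattice d → ℝ := fun a => if a ∈ J₁ then x else y with hx'
    have hcomp : (J \ J₁).card = q - k := by
      rw [Finset.card_sdiff_of_subset hJ₁, hJcard, hJ₁card]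
    have hsplit : ∀ (a : Lattice d), (a ∈ J₁ → x' a = x) ∧ (a ∈ J \ J₁ → x' a = y) :=
      fun a => ⟨fun h => if_pos h, fun h => if_neg (Finset.mem_sdiff.1 h).2⟩
    have hsum : ∑ a ∈ J, x' a = k * x + (q - k : ℕ) * y := by
      rw [← Finset.sum_sdiff hJ₁, Finset.sum_congr rfl fun a ha => (hsplit a).2 ha,
        Finset.sum_congr (s₁ := J₁) rfl fun a ha => (hsplit a).1 ha, Finset.sum_const,
        Finset.sum_const, hcomp, hJ₁card, nsmul_eq_mul, nsmul_eq_mul, add_comm]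
    set y₀ := (k * x + (q - k : ℕ) * y) / q with hy₀
    have hsum' : ∑ a ∈ J, x' a = q * y₀ := by
      rw [hsum, hy₀, mul_div_cancel₀ _ (by positivity)]
    have hy₀Y : |y₀| ≤ Y := by
      rw [hy₀, abs_div, abs_of_pos (by positivity : (0 : ℝ) < q), div_le_iff₀ (by positivity)]
      have hk' : (k : ℝ) ≤ q := by exact_mod_cast hk
      have hk'' : ((q - k : ℕ) : ℝ) ≤ q := by exact_mod_cast Nat.sub_le q k
      calc |(k : ℝ) * x + (q - k : ℕ) * y| ≤ k * |x| + (q - k : ℕ) * |y| := by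
            refine (abs_add_le _ _).trans (le_of_eq ?_)
            rw [abs_mul, abs_mul, Nat.abs_cast, Nat.abs_cast]
        _ ≤ q * |x| + q * |y| := by gcongr
        _ = Y * q := by
            rw [hY]
            ring
    have hprod := prod_le_of_blocks hω hinv hcl hm0 hn0 (hdec m) x' hε J
      (fun a ha b hb hab => disjoint_cube_blockCorners ha hb hab) (y := y₀) (ε' := ε + η) ?_
    · simp only [hμ] at hprod
      -- The decoupling cost is c(m) < η m^d per block, and the q blocks have total volume at most
      -- n^d.
      have hexp : Real.exp (-((box d n).card * η)) ≤ Real.exp (-c m) ^ q := by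
        rw [← Real.exp_nat_mul]
        refine Real.exp_le_exp.2 ?_
        rw [div_lt_iff₀ hmd] at hcm
        rw [Interaction.card_box, Nat.cast_pow]
        have h1 : (q : ℝ) * c m ≤ q * (η * (m : ℝ) ^ d) := by gcongr
        have h2 : (q : ℝ) * (m : ℝ) ^ d * η ≤ (n : ℝ) ^ d * η := by gcongr
        linarith
      refine (mul_le_mul_of_nonneg_right hexp (by positivity)).trans (le_trans (le_of_eq ?_) hprod)
      rw [Finset.prod_mul_distrib, Finset.prod_const, hJcard, ← Finset.prod_sdiff hJ₁,
        Finset.prod_congr rfl fun a ha => by rw [(hsplit a).2 ha],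
        Finset.prod_congr (s₁ := J₁) rfl fun a ha => by rw [(hsplit a).1 ha],
        Finset.prod_const, Finset.prod_const, hcomp, hJ₁card, mul_comm (_ ^ k)]
    · have hR := Ψ.norm_K_sub_sum_le J (fun a => (box d m).map (addRightEmbedding a)) (box d n)
        (fun a ha => map_box_subset_box (Nat.div_mul_le_self n p) ha)
        (fun a ha b hb hab => by
          rw [← Finset.disjoint_coe, coe_map_box, coe_map_box]
          exact (disjoint_cube_blockCorners ha hb hab).mono_left (cube_zero_subset a m (g m)))
      simp only [Interaction.totalNorm_map, Finset.sum_const, nsmul_eq_mul, hJcard] at hR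
      have hT := hΨ.totalNorm_le (box d n)
      rw [Interaction.card_box, Nat.cast_pow] at hT
      have habs : |(m : ℝ) ^ d * ∑ a ∈ J, x' a - (n : ℝ) ^ d * y₀|
          ≤ ((n : ℝ) ^ d - q * (m : ℝ) ^ d) * Y := by
        have e : (m : ℝ) ^ d * ∑ a ∈ J, x' a - (n : ℝ) ^ d * y₀
            = -(((n : ℝ) ^ d - q * (m : ℝ) ^ d) * y₀) := by
          rw [hsum']
          ring
        rw [e, abs_neg, abs_mul, abs_of_nonneg (sub_nonneg.2 hqm)]
        exact mul_le_mul_of_nonneg_left hy₀Y (sub_nonneg.2 hqm)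
      -- Uses q + 1 ≤ 2q and q m^d ≤ n^d.
      have hκq : ((q : ℝ) + 1) * κ ≤ (n : ℝ) ^ d * (2 * κ / (m : ℝ) ^ d) := by
        rw [← mul_div_assoc, le_div_iff₀ hmd]
        have hκ0 : 0 ≤ κ := norm_nonneg _
        have h1 : ((q : ℝ) + 1) * κ * (m : ℝ) ^ d ≤ (2 * q) * κ * (m : ℝ) ^ d := by
          gcongr
          linarith
        have h2 : (q : ℝ) * (m : ℝ) ^ d * (2 * κ) ≤ (n : ℝ) ^ d * (2 * κ) := by gcongr
        linarith
      have hθeq : (n : ℝ) ^ d * (((n / p : ℕ) : ℝ) / n * m) ^ d = q * (m : ℝ) ^ d := by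
        rw [← mul_pow, hq, Nat.cast_pow, ← mul_pow]
        congr 1
        field_simp
      have hn' := mul_lt_mul_of_pos_left hn hnd
      have hexp : (n : ℝ) ^ d * (2 * κ / (m : ℝ) ^ d + (B - (((n / p : ℕ) : ℝ) / n * m) ^ d *
          (Ψ.totalNorm (box d m) / (m : ℝ) ^ d)) + (1 - (((n / p : ℕ) : ℝ) / n * m) ^ d) * Y) =
          (n : ℝ) ^ d * (2 * κ / (m : ℝ) ^ d) + ((n : ℝ) ^ d * B -
            q * Ψ.totalNorm (box d m)) + ((n : ℝ) ^ d - q * (m : ℝ) ^ d) * Y := by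
        have h1 : (q : ℝ) * Ψ.totalNorm (box d m) =
            q * (m : ℝ) ^ d * (Ψ.totalNorm (box d m) / (m : ℝ) ^ d) := by
          rw [mul_assoc, mul_div_cancel₀ _ hmd.ne']
        rw [h1, ← hθeq]
        ring
      rw [hexp] at hn'
      have hε' : (q : ℝ) * (m : ℝ) ^ d * ε ≤ (n : ℝ) ^ d * ε := by gcongr
      rw [hJcard]
      linarith

end EnergyDensity

end QuantumSpin

theorem theorem4p3 {d N : ℕ} (hd : 1 ≤ d)
    (𝒜 : StarSubalgebra ℂ (Matrix (Fin N) (Fin N) ℂ))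
    (Ψ : QuantumSpin.Interaction d 𝒜) (hcl : Ψ.IsClassical) (hΨ : Ψ.FiniteNorm)
    (ω : QuantumSpin.quasiLocal d 𝒜 →ₗ[ℂ] ℂ) (hω : QuantumSpin.IsState ω)
    (hinv : QuantumSpin.IsTranslationInvariant ω)
    (hdec : QuantumSpin.AsymptoticallyDecoupled ω) :
    ∃ μ : ℕ → Measure ℝ,
      (∀ n, IsProbabilityMeasure (μ n)) ∧
      (∀ (n : ℕ) (A : Set ℝ), MeasurableSet A →
        ω (QuantumSpin.spectralProjection A
          (((QuantumSpin.box d n).card : ℝ)⁻¹ • Ψ.K (QuantumSpin.box d n)))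
          = (((μ n).real A : ℝ) : ℂ)) ∧
      ∃ (I : ℝ → ℝ≥0∞) (f : ℝ → ℝ),
        QuantumSpin.LargeDeviationPrinciple μ (fun n => ((QuantumSpin.box d n).card : ℝ)) I ∧
        ConvexOn ℝ≥0 Set.univ I ∧
        (∀ α : ℝ, Tendsto (fun n : ℕ => 1 / ((QuantumSpin.box d n).card : ℝ) *
          Real.log (ω (NormedSpace.exp (α • Ψ.K (QuantumSpin.box d n)))).re) atTop (𝓝 (f α))) ∧
        ∀ x : ℝ, -(I x : EReal) = ⨅ α : ℝ, ((f α - α * x : ℝ) : EReal) := by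
  open QuantumSpin in
  obtain ⟨g, c, hg, -, hc, hdec⟩ := hdec
  -- The same measures represent both the spectral projections and, through the functional calculus,
  -- the exponential moments.
  choose μ hprob hsupp hint hdist using fun n =>
    hω.exists_distribution (isSelfAdjoint_energyDensity Ψ n) (finite_spectrum_energyDensity Ψ n)
  have hv : Tendsto (fun n => ((box d n).card : ℝ)) atTop atTop := by
    simp only [Interaction.card_box]
    exact tendsto_natCast_atTop_atTop.comp (tendsto_pow_atTop (by omega))
  have hM : ∀ᶠ n in atTop, μ n (Set.Icc (-(‖Ψ.ψ ∅‖ + ∑' X, Ψ.originWeight X))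
      (‖Ψ.ψ ∅‖ + ∑' X, Ψ.originWeight X))ᶜ = 0 := by
    filter_upwards [eventually_gt_atTop 0] with n hn
    exact measure_mono_null (Set.compl_subset_compl.2
      (hω.spectrum_subset_Icc (norm_energyDensity_le hΨ hn))) (hsupp n)
  have H := dominatesCopies_of_decoupled hd hω hinv hcl hΨ hg hc
    (fun m a A B hA hA' hB hB' => (hdec m a A B hA hA' hB hB').1) (μ := μ) fun n x ε => by
      rw [hdist n _ measurableSet_ball, Complex.ofReal_re]
  refine ⟨μ, hprob, hdist, rateFunction μ fun n => ((box d n).card : ℝ),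
    rateLegendre μ fun n => ((box d n).card : ℝ),
    largeDeviationPrinciple_rateFunction hv hM H, convexOn_rateFunction hv H, fun α => ?_,
    neg_rateFunction_eq_iInf hv hM H⟩
  refine (tendsto_log_integral_exp hv hM H α).congr' ?_
  filter_upwards [eventually_gt_atTop 0] with n hn
  rw [exp_smul_K_eq_cfc Ψ α hn, hint, Complex.ofReal_re]
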